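/- \textbf{Setting.} Let $M$ be a strict Markov category, with copy maps $\mathrm{copy}_X : X \to X\otimes X$ and delete maps $\mathrm{del}_X : X \to I$; let $M_{\det}$ be its subcategory of deterministic morphisms (those commuting with copying). Let $\Sigma$ be a signature, i.e. a finite directed hypergraph: finite sets of wires and of boxes, each box $b$ having words $\mathrm{dom}\,b$, $\mathrm{cod}\,b$ of wires. \emph{The free Markov category} $\mathrm{FreeMarkov}(\Sigma)$ has as objects the finite words of wires of $\Sigma$. A morphism $u \to v$ is an isomorphism class of string diagrams: finite acyclic hypergraphs labelled over $\Sigma$ with an input list of type $u$ and an output list of type $v$, in which every wire starts at exactly one place (a position of the input list, or an output of a box) and no box is discarded (every box has at least one output wire that is an output of the diagram or enters a box). Composition is gluing followed by iterated deletion of discarded boxes; the tensor product is juxtaposition; copies, deletions and swaps are diagrams without boxes. A box $b$ gives a morphism $\langle b\rangle : \mathrm{dom}\,b \to \mathrm{cod}\,b$ (the delete map if $\mathrm{cod}\,b$ is empty). A \emph{generalized causal model} is a morphism whose diagram has pairwise distinct output wires. \emph{The category} $\mathrm{Joint}(M)$ has the objects of $M$. A morphism $Z \to X$ is a joint Markov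 kernel $([N,k],f)$, with $N$ an object of $M$ (the residual), $k : N\otimes Z \to X$ in $M_{\det}$ and $f : Z \to N$ in $M$, modulo the equivalence relation generated by reparametrization of residuals along deterministic $h : N \to N'$, which identifies $([N,k'\circ(h\otimes \mathrm{id}_Z)],f)$ with $([N',k'],h\circ f)$. The composite of $([N_1,k_1],f_1) : Z\to X$ with $([N_2,k_2],f_2) : X\to Y$ has residual $N_1 \otimes N_2$, computes the joint of both residuals in its second component and applies $k_1$, then $k_2$, in its first; the tensor product works in parallel; deterministic $k : Z \to X$ give morphisms $([I,k],\mathrm{del}_Z)$, among them the identities, swaps, copies and deletions. A functor $\mathrm{FreeMarkov}(\Sigma)\to\mathrm{Joint}(M)$ is \emph{strict Markov} if it strictly preserves the unit, tensor products, swaps, copies and deletions. A \emph{joint factorization} $(f,\varphi,F)$ over $\Sigma$ consists of a strict Markov functor $F : \mathrm{FreeMarkov}(\Sigma)\to\mathrm{Joint}(M)$ with a map $r$ from boxes to words of wires such that each $F\langle b\rangle$ has the form $\bigl([\bigotimes_{w\in r(b)}F(w),k_b],f_b\bigr)$, a generalized causal model $\varphi$, and the morphism $f = F(\varphi)$. An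 \emph{intervention} assigns to each box $b$ of $\Sigma$ either no intervention, $\mathrm{do}(b)=\ast$, or a deterministic point $\mathrm{do}(b)=x\in M_{\det}(I,F(\mathrm{cod}\,b))$. \textbf{Theorem (joint factorizations admit interventional distributions).} Let $(f,\varphi,F)$ be a joint factorization over $\Sigma$ in $M$, and let $\mathrm{do}$ be an intervention. Then there is a unique strict Markov functor $\mathrm{Int} : \mathrm{FreeMarkov}(\Sigma) \to \mathrm{Joint}(M)$ that agrees with $F$ on objects and satisfies, for every box $b$, \[ \mathrm{Int}\langle b\rangle = \begin{cases} F\langle b\rangle & \text{if } \mathrm{do}(b)=\ast,\\ \bigl([I,\; x\circ \mathrm{del}_{F(\mathrm{dom}\,b)}],\ \mathrm{del}_{F(\mathrm{dom}\,b)}\bigr) & \text{if } \mathrm{do}(b)=x. \end{cases} \] Consequently $\mathrm{do}$ determines a unique interventional distribution $\mathrm{Int}(\varphi) : F(\mathrm{dom}\,\varphi) \to F(\mathrm{cod}\,\varphi)$ in $\mathrm{Joint}(M)$. -/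

import Mathlib

namespace JointCausal

open CategoryTheory MonoidalCategory

universe u v w

/-! ### Joint Markov kernels -/

/-- A strict monoidal category: the tensor product of objects is strictly associative and unital, and
the associators and unitors are identities. -/
class IsStrictMonoidal (M : Type u) [Category.{v} M] [MonoidalCategory M] : Prop where
  tensor_assoc (X Y Z : M) : (X ⊗ Y) ⊗ Z = X ⊗ (Y ⊗ Z)
  unit_tensor (X : M) : 𝟙_ M ⊗ X = X
  tensor_unit (X : M) : X ⊗ 𝟙_ M = X
  associator_hom (X Y Z : M) : (α_ X Y Z).hom = eqToHom (tensor_assoc X Y Z)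
  leftUnitor_hom (X : M) : (λ_ X).hom = eqToHom (unit_tensor X)
  rightUnitor_hom (X : M) : (ρ_ X).hom = eqToHom (tensor_unit X)

section Markov
variable {M : Type u} [Category.{v} M] [MonoidalCategory M] [MarkovCategory M]

/-- The copy map of a Markov category. -/
def copy (X : M) : X ⟶ X ⊗ X := (CopyDiscardCategory.comonObj X).comul
/-- The delete map of a Markov category. -/
def del (X : M) : X ⟶ 𝟙_ M := (CopyDiscardCategory.comonObj X).counit

lemma det_iff {X Y : M} (f : X ⟶ Y) : Deterministic f ↔ f ≫ copy Y = copy X ≫ (f ⊗ₘ f) :=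
  ⟨fun h => h.hom_comul, fun h => ⟨MarkovCategory.discard_natural f, h⟩⟩

lemma comp_del {X Y : M} (f : X ⟶ Y) : f ≫ del Y = del X :=
  MarkovCategory.discard_natural f

lemma det_copy {X Y : M} (f : X ⟶ Y) (h : Deterministic f) :
    f ≫ copy Y = copy X ≫ (f ⊗ₘ f) := (det_iff f).1 h

lemma det_copy_assoc {X Y W : M} (f : X ⟶ Y) (h : Deterministic f) (g : Y ⊗ Y ⟶ W) :
    f ≫ copy Y ≫ g = copy X ≫ (f ⊗ₘ f) ≫ g := by
  rw [← Category.assoc, det_copy f h, Category.assoc]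

lemma copy_tensor (X Y : M) : copy (X ⊗ Y) = (copy X ⊗ₘ copy Y) ≫ tensorμ X X Y Y :=
  CopyDiscardCategory.copy_tensor X Y

lemma copy_unit : copy (𝟙_ M) = (λ_ (𝟙_ M)).inv := CopyDiscardCategory.copy_unit

lemma del_unit : del (𝟙_ M) = 𝟙 _ := CopyDiscardCategory.discard_unit

lemma copy_assoc (X : M) :
    copy X ≫ X ◁ copy X = copy X ≫ copy X ▷ X ≫ (α_ X X X).hom :=
  (CopyDiscardCategory.comonObj X).comul_assoc

lemma copy_assoc_assoc (X : M) {W : M} (g : X ⊗ X ⊗ X ⟶ W) :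
    copy X ≫ X ◁ copy X ≫ g = copy X ≫ copy X ▷ X ≫ (α_ X X X).hom ≫ g := by
  simpa using congrArg (· ≫ g) (copy_assoc X)

lemma copy_comm (X : M) : copy X ≫ (β_ X X).hom = copy X :=
  (CopyDiscardCategory.isCommComonObj X).comul_comm

lemma copy_del_left (X : M) : copy X ≫ del X ▷ X = (λ_ X).inv :=
  (CopyDiscardCategory.comonObj X).counit_comul

lemma copy_del_left_assoc (X : M) {W : M} (g : 𝟙_ M ⊗ X ⟶ W) :
    copy X ≫ del X ▷ X ≫ g = (λ_ X).inv ≫ g := by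
  rw [← Category.assoc, copy_del_left]

lemma copy_del_right (X : M) : copy X ≫ X ◁ del X = (ρ_ X).inv :=
  (CopyDiscardCategory.comonObj X).comul_counit

lemma copy_del_right_assoc (X : M) {W : M} (g : X ⊗ 𝟙_ M ⟶ W) :
    copy X ≫ X ◁ del X ≫ g = (ρ_ X).inv ≫ g := by
  rw [← Category.assoc, copy_del_right]

lemma det_id (X : M) : Deterministic (𝟙 X) := inferInstance
lemma det_comp {X Y Z : M} {f : X ⟶ Y} {g : Y ⟶ Z} (hf : Deterministic f)
    (hg : Deterministic g) : Deterministic (f ≫ g) := inferInstance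

lemma det_tensor {X Y X' Y' : M} {f : X ⟶ Y} {g : X' ⟶ Y'} (hf : Deterministic f)
    (hg : Deterministic g) : Deterministic (f ⊗ₘ g) := by
  rw [det_iff, copy_tensor, copy_tensor, tensorHom_comp_tensorHom_assoc, det_copy f hf, det_copy g hg,
    Category.assoc, ← tensorμ_natural, tensorHom_comp_tensorHom_assoc]

lemma det_whiskerRight {X Y : M} {f : X ⟶ Y} (hf : Deterministic f) (Z : M) :
    Deterministic (f ▷ Z) := by
  rw [← tensorHom_id]; exact det_tensor hf (det_id Z)

lemma det_whiskerLeft {X Y : M} {f : X ⟶ Y} (hf : Deterministic f) (Z : M) :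
    Deterministic (Z ◁ f) := by
  rw [← id_tensorHom]; exact det_tensor (det_id Z) hf

lemma det_inv {X Y : M} (e : X ≅ Y) (h : Deterministic e.hom) : Deterministic e.inv :=
  inferInstance

lemma det_assoc (X Y Z : M) : Deterministic (α_ X Y Z).hom := by
  rw [det_iff, copy_tensor, copy_tensor, copy_tensor, copy_tensor]
  have h := tensor_associativity X X Y Y Z Z
  calc _ = ((copy X ⊗ₘ copy Y) ⊗ₘ copy Z) ≫ (α_ _ _ _).hom ≫
        ((X ⊗ X) ◁ tensorμ Y Y Z Z) ≫ tensorμ X X (Y ⊗ Z) (Y ⊗ Z) := by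
        rw [associator_naturality_assoc, ← id_tensorHom, tensorHom_comp_tensorHom_assoc,
          Category.comp_id]
    _ = _ := by
        rw [← h, ← tensorHom_id, tensorHom_comp_tensorHom_assoc]; simp

lemma det_leftUnitor (X : M) : Deterministic (λ_ X).hom := by
  rw [det_iff, copy_tensor, copy_unit, Category.assoc, MonoidalCategory.tensorHom_def', Category.assoc,
    ← tensor_left_unitality, leftUnitor_naturality]

lemma det_rightUnitor (X : M) : Deterministic (ρ_ X).hom := by
  rw [det_iff, copy_tensor, copy_unit, Category.assoc, MonoidalCategory.tensorHom_def, Category.assoc,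
    ← tensor_right_unitality, rightUnitor_naturality]

lemma braiding_tensorμ (X Y : M) : (β_ (X ⊗ X) (Y ⊗ Y)).hom ≫ tensorμ Y Y X X =
    tensorμ X X Y Y ≫ ((β_ X Y).hom ⊗ₘ (β_ X Y).hom) := by
  simp only [tensorμ, BraidedCategory.braiding_tensor_left_hom,
    BraidedCategory.braiding_tensor_right_hom]
  calc _ = 𝟙 _ ⊗≫ X ◁ (β_ X Y).hom ▷ Y ⊗≫ (β_ X Y).hom ▷ (X ⊗ Y) ⊗≫ (Y ⊗ X) ◁ (β_ X Y).hom ⊗≫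
        Y ◁ ((β_ X Y).hom ≫ (β_ Y X).hom) ▷ X ⊗≫ 𝟙 _ := by monoidal
    _ = _ := by
      rw [SymmetricCategory.symmetry, MonoidalCategory.tensorHom_def]
      monoidal

lemma det_braiding (X Y : M) : Deterministic (β_ X Y).hom := by
  rw [det_iff, copy_tensor, copy_tensor, Category.assoc, ← braiding_tensorμ,
    BraidedCategory.braiding_naturality_assoc]

lemma det_copy' (X : M) : Deterministic (copy X) := by
  rw [det_iff, copy_tensor]
  have h : copy X ≫ (copy X ⊗ₘ copy X) = copy X ≫ X ◁ copy X ≫ X ◁ (copy X ▷ X) ≫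
      X ◁ (α_ X X X).hom ≫ (α_ X X (X ⊗ X)).inv := by
    have e : X ◁ copy X ≫ X ◁ (copy X ▷ X) ≫ X ◁ (α_ X X X).hom =
        X ◁ copy X ≫ X ◁ (X ◁ copy X) := by
      simp only [← MonoidalCategory.whiskerLeft_comp, copy_assoc]
    rw [reassoc_of% e, MonoidalCategory.tensorHom_def, copy_assoc_assoc]
    monoidal
  rw [reassoc_of% h, h, tensorμ]
  simp only [Iso.inv_hom_id_assoc, ← MonoidalCategory.whiskerLeft_comp_assoc,
    Iso.hom_inv_id_assoc, ← comp_whiskerRight_assoc, copy_comm]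

lemma det_del (X : M) : Deterministic (del X) := by
  have h : copy X ≫ (del X ⊗ₘ del X) = del X ≫ (λ_ (𝟙_ M)).inv := by
    rw [MonoidalCategory.tensorHom_def, copy_del_left_assoc, leftUnitor_inv_naturality]
  rw [det_iff, copy_unit, h]

lemma det_tensorμ (W X Y Z : M) : Deterministic (tensorμ W X Y Z) := by
  unfold tensorμ
  exact det_comp (det_assoc _ _ _) (det_comp (det_whiskerLeft (det_inv _ (det_assoc _ _ _)) _)
    (det_comp (det_whiskerLeft (det_whiskerRight (det_braiding _ _) _) _)
    (det_comp (det_whiskerLeft (det_assoc _ _ _) _) (det_inv _ (det_assoc _ _ _)))))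


/-- The joint kernel `z ↦ (m, k (m, z))`, with `m` distributed as `f z`, of residual and output. -/
def jointly {Z N X : M} (f : Z ⟶ N) (k : N ⊗ Z ⟶ X) : Z ⟶ N ⊗ X :=
  copy Z ≫ (f ≫ copy N) ▷ Z ≫ (α_ N N Z).hom ≫ N ◁ k

lemma jointly_reparam {Z N N' X : M} (f : Z ⟶ N) (k : N' ⊗ Z ⟶ X) (h : N ⟶ N')
    (hh : Deterministic h) :
    jointly f (h ▷ Z ≫ k) ≫ h ▷ X = jointly (f ≫ h) k := by
  simp only [jointly, Category.assoc, det_copy h hh, comp_whiskerRight]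
  congr 2
  rw [whisker_exchange, MonoidalCategory.tensorHom_def]
  monoidal

lemma jointly_id (Z : M) : jointly (del Z) (λ_ Z).hom ≫ (λ_ Z).hom = 𝟙 Z := by
  simp only [jointly, copy_unit, comp_whiskerRight, Category.assoc, copy_del_left_assoc]
  monoidal

lemma jointly_del {Z N X : M} (f : Z ⟶ N) (k : N ⊗ Z ⟶ X) :
    jointly f k ≫ N ◁ del X ≫ (ρ_ N).hom = f := by
  have h : N ◁ k ≫ N ◁ del X = N ◁ (N ◁ del Z ≫ (ρ_ N).hom ≫ del N) := by
    rw [← MonoidalCategory.whiskerLeft_comp, comp_del, comp_del, comp_del]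
  simp only [jointly, Category.assoc, reassoc_of% h]
  calc _ = copy Z ≫ Z ◁ del Z ≫ (ρ_ Z).hom ≫ f ≫ copy N ≫ N ◁ del N ≫ (ρ_ N).hom := by
        rw [← rightUnitor_naturality_assoc, ← rightUnitor_naturality_assoc,
          whisker_exchange_assoc, whisker_exchange_assoc]
        monoidal
    _ = f := by
        rw [copy_del_right_assoc, copy_del_right_assoc]; simp

lemma jointly_jointly {Z N X N' Y : M} (f : Z ⟶ N) (k : N ⊗ Z ⟶ X) (hk : Deterministic k)
    (f' : X ⟶ N') (k' : N' ⊗ X ⟶ Y) :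
    jointly (jointly f k ≫ N ◁ f') ((β_ N N').hom ▷ Z ≫ (α_ N' N Z).hom ≫ N' ◁ k ≫ k') ≫
      (α_ N N' Y).hom = jointly f k ≫ N ◁ jointly f' k' := by
  obtain ⟨g, hg⟩ : ∃ g, g = k ≫ f' ≫ copy N' := ⟨_, rfl⟩
  obtain ⟨h, hh⟩ : ∃ h, h = N' ◁ k ≫ k' := ⟨_, rfl⟩
  have e1 : N ◁ k ≫ N ◁ f' ≫ copy (N ⊗ N') =
      copy N ▷ (N ⊗ Z) ≫ (N ⊗ N) ◁ g ≫ tensorμ N N N' N' := by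
    rw [copy_tensor, hg, MonoidalCategory.tensorHom_def', ← whisker_exchange_assoc]
    simp only [Category.assoc, MonoidalCategory.whiskerLeft_comp, whisker_exchange_assoc]
  have e2 : k ≫ jointly f' k' = (copy N ⊗ₘ copy Z) ≫ tensorμ N N Z Z ≫ g ▷ (N ⊗ Z) ≫
      (α_ _ _ _).hom ≫ N' ◁ h := by
    unfold jointly
    rw [det_copy_assoc k hk, copy_tensor, hg, hh, Category.assoc,
      MonoidalCategory.tensorHom_def k k, Category.assoc, whisker_exchange_assoc]
    monoidal
  have e3 : copy N ≫ copy N ▷ N ≫ (α_ N N N).hom ≫ N ◁ (β_ N N).hom =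
      copy N ≫ N ◁ copy N := by
    rw [← copy_assoc_assoc, ← MonoidalCategory.whiskerLeft_comp, copy_comm]
  rw [← hh]
  calc _ = copy Z ≫ copy Z ▷ Z ≫ f ▷ Z ▷ Z ≫ copy N ▷ Z ▷ Z ⊗≫ copy N ▷ (N ⊗ Z ⊗ Z) ⊗≫
        N ◁ ((N ◁ g ≫ (β_ N (N' ⊗ N')).hom) ▷ Z) ⊗≫ N ◁ N' ◁ h ⊗≫ 𝟙 _ := by
        rw [BraidedCategory.braiding_tensor_right_hom]
        conv_lhs => rw [jointly, jointly]
        rw [show (copy Z ≫ (f ≫ copy N) ▷ Z ≫ (α_ N N Z).hom ≫ N ◁ k) ≫ N ◁ f' = copy Z ≫ (f ≫ copy N) ▷ Z ≫ (α_ N N Z).hom ≫ N ◁ k ≫ N ◁ f' by simp only [Category.assoc]]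
        simp only [Category.assoc, e1]
        rw [tensorμ]
        monoidal
    _ = (copy Z ≫ copy Z ▷ Z ≫ (α_ Z Z Z).hom) ⊗≫ f ▷ (Z ⊗ Z) ⊗≫ (copy N ≫ copy N ▷ N ≫ (α_ N N N).hom ≫
        N ◁ (β_ N N).hom) ▷ (Z ⊗ Z) ⊗≫
        N ◁ (N ◁ (β_ N Z).hom ▷ Z) ⊗≫ N ◁ g ▷ (N ⊗ Z) ⊗≫ N ◁ N' ◁ h ⊗≫ 𝟙 _ := by
        rw [BraidedCategory.braiding_naturality_right, BraidedCategory.braiding_tensor_right_hom]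
        monoidal
    _ = (copy Z ≫ Z ◁ copy Z) ⊗≫ f ▷ (Z ⊗ Z) ⊗≫ (copy N ≫ N ◁ copy N) ▷ (Z ⊗ Z) ⊗≫
        N ◁ (N ◁ (β_ N Z).hom ▷ Z) ⊗≫ N ◁ g ▷ (N ⊗ Z) ⊗≫ N ◁ N' ◁ h ⊗≫ 𝟙 _ := by
        rw [e3, ← copy_assoc Z]
    _ = copy Z ≫ (Z ◁ copy Z ≫ (f ≫ copy N) ▷ (Z ⊗ Z)) ⊗≫ (N ◁ copy N) ▷ (Z ⊗ Z) ⊗≫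
        N ◁ (N ◁ (β_ N Z).hom ▷ Z) ⊗≫ N ◁ g ▷ (N ⊗ Z) ⊗≫ N ◁ N' ◁ h ⊗≫ 𝟙 _ := by monoidal
    _ = _ := by
        conv_rhs => rw [jointly]
        simp only [Category.assoc, ← MonoidalCategory.whiskerLeft_comp, e2]
        rw [tensorμ, MonoidalCategory.tensorHom_def', whisker_exchange]
        monoidal


/-- A joint Markov kernel `([N, k], f)` from `Z` to `X`: a residual `N`, a deterministic mechanism
`k : N ⊗ Z ⟶ X`, and a noise kernel `f : Z ⟶ N`. -/
structure JointKernel (Z X : M) where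
  /-- the residual `N` -/
  res : M
  /-- the mechanism `k` -/
  mech : res ⊗ Z ⟶ X
  det : Deterministic mech
  /-- the conditional distribution `f` of the residual -/
  noise : Z ⟶ res

namespace JointKernel

/-- A deterministic reparametrization of residuals: a deterministic `h : N ⟶ N'` with
`f' = f ≫ h` and `k = (h ⊗ id) ≫ k'`. -/
def Reparam {Z X : M} (a b : JointKernel Z X) : Prop :=
  ∃ h : a.res ⟶ b.res, Deterministic h ∧ a.noise ≫ h = b.noise ∧ h ▷ Z ≫ b.mech = a.mech

/-- The joint Markov kernel `([I, k], del)` of a deterministic morphism `k`. -/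
def ofDet {Z X : M} (k : Z ⟶ X) (hk : Deterministic k) : JointKernel Z X where
  res := 𝟙_ M
  mech := (λ_ Z).hom ≫ k
  det := det_comp (det_leftUnitor Z) hk
  noise := del Z

/-- Composition: the residual is `N ⊗ N'`, the mechanism is `(n, n', z) ↦ k' (n', k (n, z))`, and
the noise draws `n` from `f z` and then `n'` from `f' (k (n, z))`. -/
def comp {Z X Y : M} (a : JointKernel Z X) (b : JointKernel X Y) : JointKernel Z Y where
  res := a.res ⊗ b.res
  mech := (β_ a.res b.res).hom ▷ Z ≫ (α_ b.res a.res Z).hom ≫ b.res ◁ a.mech ≫ b.mech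
  det := det_comp (det_whiskerRight (det_braiding _ _) _) (det_comp (det_assoc _ _ _)
    (det_comp (det_whiskerLeft a.det _) b.det))
  noise := jointly a.noise a.mech ≫ a.res ◁ b.noise

/-- Monoidal product: pair the mechanisms and the noise distributions. -/
def tensor {Z X W Y : M} (a : JointKernel Z X) (b : JointKernel W Y) :
    JointKernel (Z ⊗ W) (X ⊗ Y) where
  res := a.res ⊗ b.res
  mech := tensorμ a.res b.res Z W ≫ (a.mech ⊗ₘ b.mech)
  det := det_comp (det_tensorμ _ _ _ _) (det_tensor a.det b.det)
  noise := a.noise ⊗ₘ b.noise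

lemma Reparam.refl {Z X : M} (a : JointKernel Z X) : Reparam a a :=
  ⟨𝟙 _, det_id _, by simp, by simp⟩

lemma Reparam.comp_left {Z X Y : M} {a a' : JointKernel Z X} (h : Reparam a a')
    (b : JointKernel X Y) : Reparam (a.comp b) (a'.comp b) := by
  obtain ⟨h, hd, h1, h2⟩ := h
  refine ⟨h ▷ b.res, det_whiskerRight hd _, ?_, ?_⟩
  · simp only [comp, Category.assoc, ← h1, ← h2]
    rw [whisker_exchange, ← jointly_reparam _ _ _ hd, Category.assoc]
  · simp only [comp, ← h2]
    rw [← comp_whiskerRight_assoc, BraidedCategory.braiding_naturality_left]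
    monoidal

lemma Reparam.comp_right {Z X Y : M} (a : JointKernel Z X) {b b' : JointKernel X Y}
    (h : Reparam b b') : Reparam (a.comp b) (a.comp b') := by
  obtain ⟨h, hd, h1, h2⟩ := h
  refine ⟨a.res ◁ h, det_whiskerLeft hd _, ?_, ?_⟩
  · simp only [comp, Category.assoc, ← h1, MonoidalCategory.whiskerLeft_comp]
  · simp only [comp, ← h2]
    rw [← comp_whiskerRight_assoc, BraidedCategory.braiding_naturality_right,
      whisker_exchange_assoc]
    monoidal

lemma Reparam.tensor {Z X W Y : M} {a a' : JointKernel Z X} {b b' : JointKernel W Y}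
    (h : Reparam a a') (h' : Reparam b b') : Reparam (a.tensor b) (a'.tensor b') := by
  obtain ⟨h, hd, h1, h2⟩ := h
  obtain ⟨h', hd', h1', h2'⟩ := h'
  refine ⟨h ⊗ₘ h', det_tensor hd hd', ?_, ?_⟩
  · simp only [JointKernel.tensor, tensorHom_comp_tensorHom, h1, h1']
  · simp only [JointKernel.tensor]
    rw [tensorμ_natural_left_assoc, tensorHom_comp_tensorHom, h2, h2']

lemma id_comp_reparam {Z X : M} (a : JointKernel Z X) :
    Reparam ((ofDet (𝟙 Z) (det_id Z)).comp a) a := by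
  refine ⟨(λ_ a.res).hom, det_leftUnitor _, ?_, ?_⟩
  · simp only [comp, ofDet, Category.comp_id, Category.assoc, leftUnitor_naturality]
    rw [reassoc_of% (jointly_id Z)]
  · simp only [comp, ofDet, Category.comp_id, triangle_assoc, ← comp_whiskerRight_assoc,
      braiding_rightUnitor]

lemma comp_id_reparam {Z X : M} (a : JointKernel Z X) :
    Reparam (a.comp (ofDet (𝟙 X) (det_id X))) a := by
  refine ⟨(ρ_ a.res).hom, det_rightUnitor _, ?_, ?_⟩
  · simp only [comp, ofDet, Category.assoc, jointly_del]
  · simp only [comp, ofDet, Category.comp_id, leftUnitor_naturality]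
    rw [← braiding_leftUnitor]
    monoidal

lemma assoc_reparam {W X Y Z : M} (a : JointKernel W X) (b : JointKernel X Y)
    (c : JointKernel Y Z) : Reparam ((a.comp b).comp c) (a.comp (b.comp c)) := by
  refine ⟨(α_ _ _ _).hom, det_assoc _ _ _, ?_, ?_⟩
  · simp only [comp, Category.assoc]
    rw [associator_naturality_right, reassoc_of% (jointly_jointly a.noise a.mech a.det b.noise b.mech)]
    simp
  · simp only [comp]
    calc _ = (α_ a.res b.res c.res).hom ▷ W ≫ (β_ a.res (b.res ⊗ c.res)).hom ▷ W ⊗≫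
          ((b.res ⊗ c.res) ◁ a.mech ≫ (β_ b.res c.res).hom ▷ X) ⊗≫ c.res ◁ b.mech ≫ c.mech := by
          monoidal
      _ = 𝟙 _ ⊗≫ (((β_ a.res b.res).hom ▷ c.res ≫ (β_ (b.res ⊗ a.res) c.res).hom) ▷ W) ⊗≫
          c.res ◁ b.res ◁ a.mech ⊗≫ c.res ◁ b.mech ≫ c.mech := by
          rw [whisker_exchange, BraidedCategory.braiding_tensor_left_hom,
            BraidedCategory.braiding_tensor_right_hom]
          monoidal
      _ = _ := by
          rw [BraidedCategory.braiding_naturality_left]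
          monoidal

end JointKernel


/-- Morphisms of `Joint M`: joint Markov kernels, up to the equivalence relation generated by
deterministic reparametrization of the residual. -/
def JointHom (Z X : M) : Type (max u v) := Quot (JointKernel.Reparam (Z := Z) (X := X))

namespace JointHom

/-- Composition of joint Markov kernels. -/
def comp {Z X Y : M} : JointHom Z X → JointHom X Y → JointHom Z Y :=
  Quot.map₂ JointKernel.comp (fun a _ _ h => h.comp_right a) (fun _ _ b h => h.comp_left b)

/-- Monoidal product of joint Markov kernels. -/
def tensor {Z X W Y : M} : JointHom Z X → JointHom W Y → JointHom (Z ⊗ W) (X ⊗ Y) :=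
  Quot.map₂ JointKernel.tensor (fun a _ _ h => (JointKernel.Reparam.refl a).tensor h)
    (fun _ _ b h => h.tensor (.refl b))

end JointHom

end Markov

/-- The category of joint Markov kernels; it has the objects of `M`. -/
structure Joint (M : Type u) where
  of ::
  obj : M

section

variable {M : Type u} [Category.{v} M] [MonoidalCategory M] [MarkovCategory M]

instance : Category (Joint M) where
  Hom Z X := JointHom Z.obj X.obj
  id Z := Quot.mk _ (.ofDet (𝟙 Z.obj) (det_id Z.obj))
  comp f g := JointHom.comp f g
  id_comp f := by
    induction f using Quot.ind
    exact Quot.sound (JointKernel.id_comp_reparam _)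
  comp_id f := by
    induction f using Quot.ind
    exact Quot.sound (JointKernel.comp_id_reparam _)
  assoc f g h := by
    induction f using Quot.ind
    induction g using Quot.ind
    induction h using Quot.ind
    exact Quot.sound (JointKernel.assoc_reparam _ _ _)

end

/-! ### String diagrams and the free Markov category -/

section

/-- A hypergraph: wires, boxes, and a list of input wires and of output wires for every box.
A (monoidal) signature is a hypergraph with finitely many wires and boxes. -/
structure Hypergraph where
  Wire : Type w
  Box : Type w
  dom : Box → List Wire
  cod : Box → List Wire

/-- A hypergraph morphism. -/
structure Hypergraph.Hom (G : Hypergraph.{u}) (H : Hypergraph.{w}) where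
  wire : G.Wire → H.Wire
  box : G.Box → H.Box
  dom_box : ∀ b, H.dom (box b) = (G.dom b).map wire
  cod_box : ∀ b, H.cod (box b) = (G.cod b).map wire

variable {S : Hypergraph.{w}}

/-- The starting places of wires in a string diagram with input word `u` and boxes `b : B` labelled
by boxes of `S`: either an input of the diagram, or an output of one of its boxes. As every wire of
a string diagram has exactly one starting place, this type is used as its set of wires. -/
abbrev Place {B : Type} (u : List S.Wire) (label : B → S.Box) : Type :=
  Fin u.length ⊕ Σ b : B, Fin (S.cod (label b)).length

namespace Place

variable {B B' B'' : Type} {u : List S.Wire} {label : B → S.Box} {label' : B' → S.Box}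
  {label'' : B'' → S.Box}

/-- The label in `S` of a wire. -/
def type : Place u label → S.Wire
  | .inl i => u.get i
  | .inr ⟨b, j⟩ => (S.cod (label b)).get j

/-- The action on wires of a label preserving map of boxes. -/
def map (f : B → B') (h : ∀ b, label' (f b) = label b) : Place u label → Place u label'
  | .inl i => .inl i
  | .inr ⟨b, j⟩ => .inr ⟨f b, j.cast (by rw [h b])⟩

/-- A wire seen as a wire of the diagram restricted to the boxes satisfying `P`. -/
def restrict {P : B → Prop} : (p : Place u label) → (∀ b j, p = .inr ⟨b, j⟩ → P b) →
    Place u (fun b : {b // P b} => label b.1)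
  | .inl i, _ => .inl i
  | .inr ⟨b, j⟩, h => .inr ⟨⟨b, h b j rfl⟩, j⟩

lemma inr_eq {b b' : B} {j : Fin (S.cod (label b)).length} {j' : Fin (S.cod (label b')).length}
    (h : b = b') (hj : j.val = j'.val) :
    (.inr ⟨b, j⟩ : Place u label) = .inr ⟨b', j'⟩ := by
  subst h; rw [Fin.ext hj]

lemma map_id (f : B → B) (hf : ∀ b, f b = b) (h : ∀ b, label (f b) = label b)
    (p : Place u label) : map f h p = p := by
  obtain i | ⟨b, j⟩ := p
  · rfl
  · exact inr_eq (hf b) rfl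

lemma map_map (f : B → B') (g : B' → B'') (h : ∀ b, label' (f b) = label b)
    (h' : ∀ b, label'' (g b) = label' b) (p : Place u label) :
    map g h' (map f h p) = map (g ∘ f) (fun b => (h' _).trans (h b)) p := by
  obtain i | ⟨b, j⟩ := p <;> rfl

lemma map_congr {f g : B → B'} (hfg : ∀ b, f b = g b) (h : ∀ b, label' (f b) = label b)
    (h' : ∀ b, label' (g b) = label b) (p : Place u label) : map f h p = map g h' p := by
  obtain i | ⟨b, j⟩ := p
  · rfl
  · exact inr_eq (hfg b) rfl

lemma map_injective (f : B → B') (h : ∀ b, label' (f b) = label b) (hf : Function.Injective f) :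
    Function.Injective (map f h : Place u label → Place u label') := by
  rintro (i | ⟨b, j⟩) (i' | ⟨b', j'⟩) e
  · simpa [map] using e
  · simp [map] at e
  · simp [map] at e
  · simp only [map, Sum.inr.injEq, Sigma.mk.injEq] at e
    obtain ⟨e1, e2⟩ := e
    obtain rfl := hf e1
    exact inr_eq rfl (by simpa [Fin.ext_iff] using e2)

lemma type_map (f : B → B') (h : ∀ b, label' (f b) = label b) (p : Place u label) :
    (map f h p).type = p.type := by
  obtain i | ⟨b, j⟩ := p
  · rfl
  · simp [map, type, h]

lemma map_restrict {P : B → Prop} (p : Place u label) (h : ∀ b j, p = .inr ⟨b, j⟩ → P b) :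
    map Subtype.val (fun _ => rfl) (restrict p h) = p := by
  obtain i | ⟨b, j⟩ := p <;> rfl

lemma type_restrict {P : B → Prop} (p : Place u label) (h : ∀ b j, p = .inr ⟨b, j⟩ → P b) :
    (restrict p h).type = p.type := by
  obtain i | ⟨b, j⟩ := p <;> rfl

lemma map_pmap_restrict {P : B → Prop} (l : List (Place u label))
    (h : ∀ p ∈ l, ∀ b j, p = .inr ⟨b, j⟩ → P b) :
    (l.pmap restrict h).map (map Subtype.val fun _ => rfl) = l := by
  induction l with
  | nil => rfl
  | cons p l ih =>
    rw [List.pmap, List.map_cons, ih, map_restrict]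

lemma map_type_map (f : B → B') (h : ∀ b, label' (f b) = label b) (l : List (Place u label)) :
    (l.map (map f h)).map type = l.map type := by
  rw [List.map_map]
  exact List.map_congr_left fun p _ => type_map f h p

end Place

/-- A string diagram over `S` from the word `u` to the word `v`, that is, a cospan
`u → G ← v` of finite hypergraphs over `S` (compare `graph` and `typing` below) such that `G` is
acyclic and every wire of `G` is either the image of exactly one input and of no box output, or
exactly one output of exactly one box and no input. Accordingly the wires of `G` are the elements
of `Place u label`, with left leg `Sum.inl`; `label` is the labelling of boxes, `src b` the list of
wires that enter the box `b`, and `out` the right leg, listing the wires that leave the diagram. -/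
structure Diagram (S : Hypergraph.{w}) (u v : List S.Wire) where
  Box : Type
  finite : Finite Box
  label : Box → S.Box
  src : Box → List (Place u label)
  out : List (Place u label)
  src_type : ∀ b, (src b).map Place.type = S.dom (label b)
  out_type : out.map Place.type = v
  acyclic : ∀ b, ¬ Relation.TransGen (fun b b' => ∃ j, .inr ⟨b, j⟩ ∈ src b') b b

namespace Diagram

variable {u v x y u' v' : List S.Wire}

/-- The hypergraph of a diagram. -/
def graph (d : Diagram S u v) : Hypergraph.{0} where
  Wire := Place u d.label
  Box := d.Box
  dom := d.src
  cod b := (List.finRange _).map fun j => .inr ⟨b, j⟩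

/-- `d.Feeds b b'`: some output of `b` is an input of `b'`. -/
def Feeds (d : Diagram S u v) (b b' : d.Box) : Prop := ∃ j, .inr ⟨b, j⟩ ∈ d.src b'

/-- An embedding of diagrams: an injective map of boxes (and of wires) commuting with the labels,
the inputs, the outputs and the legs. Its image contains every box that is not discarded. -/
structure Hom (d d' : Diagram S u v) where
  box : d.Box → d'.Box
  injective : Function.Injective box
  label_eq : ∀ b, d'.label (box b) = d.label b
  src_eq : ∀ b, d'.src (box b) = (d.src b).map (Place.map box label_eq)
  out_eq : d'.out = d.out.map (Place.map box label_eq)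

/-- Isomorphism of diagrams (as cospans over `S`). -/
def Iso (d d' : Diagram S u v) : Prop := ∃ e : Hom d d', Function.Bijective e.box

lemma Iso.refl (d : Diagram S u v) : Iso d d :=
  ⟨⟨id, Function.injective_id, fun _ => rfl,
    fun b => by rw [List.map_congr_left fun p _ => Place.map_id id (fun _ => rfl) _ p]; simp,
    by rw [List.map_congr_left fun p _ => Place.map_id id (fun _ => rfl) _ p]; simp⟩,
    Function.bijective_id⟩

/-- Composition of embeddings. -/
def Hom.comp {d d' d'' : Diagram S u v} (e : Hom d d') (e' : Hom d' d'') : Hom d d'' where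
  box := e'.box ∘ e.box
  injective := e'.injective.comp e.injective
  label_eq b := (e'.label_eq _).trans (e.label_eq b)
  src_eq b := by
    simp only [Function.comp, e'.src_eq, e.src_eq, List.map_map]
    exact List.map_congr_left fun p _ => Place.map_map _ _ _ _ p
  out_eq := by
    simp only [e'.out_eq, e.out_eq, List.map_map]
    exact List.map_congr_left fun p _ => Place.map_map _ _ _ _ p

lemma Iso.trans {d d' d'' : Diagram S u v} (h : Iso d d') (h' : Iso d' d'') : Iso d d'' := by
  obtain ⟨e, he⟩ := h
  obtain ⟨e', he'⟩ := h'
  exact ⟨e.comp e', he'.comp he⟩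

lemma Iso.symm {d d' : Diagram S u v} (h : Iso d d') : Iso d' d := by
  obtain ⟨e, he⟩ := h
  let f := Equiv.ofBijective e.box he
  have hf : ∀ b, e.box (f.symm b) = b := f.apply_symm_apply
  have hf' : ∀ b, f.symm (e.box b) = b := f.symm_apply_apply
  have hl : ∀ b, d.label (f.symm b) = d'.label b := fun b => by rw [← e.label_eq, hf]
  have key : ∀ l : List (Place u d.label),
      (l.map (Place.map e.box e.label_eq)).map (Place.map f.symm hl) = l := by
    intro l
    rw [List.map_map, List.map_congr_left (g := id), List.map_id]
    intro p _
    exact (Place.map_map _ _ _ _ p).trans (Place.map_id _ hf' _ p)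
  refine ⟨⟨f.symm, f.symm.injective, hl, fun b => ?_, ?_⟩, f.symm.bijective⟩
  · conv_rhs => rw [← hf b, e.src_eq, key]
  · rw [e.out_eq, key]

/-- The boxes that survive the iterated deletion of discarded boxes, i.e. of boxes all of whose
outputs are neither outputs of the diagram nor inputs of a box: those from which there is a
directed path to an output of the diagram. -/
inductive Live (d : Diagram S u v) : d.Box → Prop
  | out {b j} : .inr ⟨b, j⟩ ∈ d.out → Live d b
  | feed {b b'} : d.Feeds b b' → Live d b' → Live d b

/-- No box is discarded: every box has an output wire that is an output of the diagram or enters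
some box. -/
def Normalized (d : Diagram S u v) : Prop :=
  ∀ b, ∃ j, .inr ⟨b, j⟩ ∈ d.out ∨ ∃ b', .inr ⟨b, j⟩ ∈ d.src b'

/-- The normalization of a diagram: iterate the deletion of discarded boxes to its fixed point. -/
def norm (d : Diagram S u v) : Diagram S u v where
  Box := {b // d.Live b}
  finite := have := d.finite; inferInstance
  label b := d.label b.1
  src b := (d.src b.1).pmap Place.restrict fun _ hp _ j e => .feed ⟨j, e ▸ hp⟩ b.2
  out := d.out.pmap Place.restrict fun _ hp _ _ e => .out (e ▸ hp)
  src_type b := by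
    rw [← Place.map_type_map (label' := d.label) Subtype.val fun _ => rfl,
      Place.map_pmap_restrict, d.src_type]
  out_type := by
    rw [← Place.map_type_map (label' := d.label) Subtype.val fun _ => rfl,
      Place.map_pmap_restrict, d.out_type]
  acyclic b h := d.acyclic b.1 <| h.lift Subtype.val fun b b' ⟨j, hj⟩ => ⟨j, by
    rw [← Place.map_pmap_restrict (d.src b'.1)]
    exact List.mem_map_of_mem hj⟩

lemma norm_normalized (d : Diagram S u v) : d.norm.Normalized := by
  rintro ⟨b, hb⟩
  have key : ∀ (l : List (Place u d.label)) (h : ∀ p ∈ l, ∀ b j, p = .inr ⟨b, j⟩ → d.Live b) j,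
      .inr ⟨b, j⟩ ∈ l → .inr ⟨⟨b, hb⟩, j⟩ ∈ l.pmap Place.restrict h := fun l h j hm =>
    List.mem_pmap.2 ⟨_, hm, rfl⟩
  cases hb with
  | out h => exact ⟨_, .inl (key _ _ _ h)⟩
  | feed h h' =>
    obtain ⟨j, h⟩ := h
    exact ⟨j, .inr ⟨⟨_, h'⟩, key _ _ _ h⟩⟩

/-- The inclusion of the live part. -/
def normIncl (d : Diagram S u v) : Hom d.norm d where
  box := Subtype.val
  injective := Subtype.val_injective
  label_eq _ := rfl
  src_eq _ := (Place.map_pmap_restrict _ _).symm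
  out_eq := (Place.map_pmap_restrict _ _).symm

lemma Normalized.live {d : Diagram S u v} (h : d.Normalized) (b : d.Box) : d.Live b := by
  have := d.finite
  have wf : WellFounded (Function.swap (Relation.TransGen d.Feeds)) :=
    have : Std.Irrefl (Function.swap (Relation.TransGen d.Feeds)) := ⟨d.acyclic⟩
    have : IsTrans _ (Function.swap (Relation.TransGen d.Feeds)) := ⟨fun _ _ _ h h' => h'.trans h⟩
    Finite.wellFounded_of_trans_of_irrefl _
  induction b using wf.induction with
  | _ b ih =>
    obtain ⟨j, hj | ⟨b', hb'⟩⟩ := h b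
    · exact .out hj
    · exact .feed ⟨j, hb'⟩ (ih b' (.single ⟨j, hb'⟩))

lemma Normalized.norm_iso {d : Diagram S u v} (h : d.Normalized) : Iso d.norm d :=
  ⟨d.normIncl, Subtype.val_injective, fun b => ⟨⟨b, h.live b⟩, rfl⟩⟩

lemma Hom.mem_out {d d' : Diagram S u v} (e : Hom d d') {b j} (h : .inr ⟨b, j⟩ ∈ d'.out) :
    ∃ a j', e.box a = b ∧ .inr ⟨a, j'⟩ ∈ d.out := by
  rw [e.out_eq] at h
  obtain ⟨i | ⟨a, j'⟩, hp, hq⟩ := List.mem_map.1 h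
  · cases hq
  · cases hq
    exact ⟨a, j', rfl, hp⟩

lemma Hom.mem_src {d d' : Diagram S u v} (e : Hom d d') {b j c}
    (h : .inr ⟨b, j⟩ ∈ d'.src (e.box c)) :
    ∃ a j', e.box a = b ∧ .inr ⟨a, j'⟩ ∈ d.src c := by
  rw [e.src_eq] at h
  obtain ⟨i | ⟨a, j'⟩, hp, hq⟩ := List.mem_map.1 h
  · cases hq
  · cases hq
    exact ⟨a, j', rfl, hp⟩

lemma Hom.live {d d' : Diagram S u v} (e : Hom d d') {a : d.Box} (h : d.Live a) :
    d'.Live (e.box a) := by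
  induction h with
  | out h =>
    exact .out (by rw [e.out_eq]; exact List.mem_map_of_mem (f := Place.map e.box e.label_eq) h)
  | feed h _ ih =>
    obtain ⟨j, h⟩ := h
    refine .feed ⟨j.cast (by rw [e.label_eq]), ?_⟩ ih
    rw [e.src_eq]; exact List.mem_map_of_mem (f := Place.map e.box e.label_eq) h

lemma Hom.exists_live {d d' : Diagram S u v} (e : Hom d d') {b : d'.Box} (h : d'.Live b) :
    ∃ a, e.box a = b ∧ d.Live a := by
  induction h with
  | out h =>
    obtain ⟨a, j', rfl, h'⟩ := e.mem_out h
    exact ⟨a, rfl, .out h'⟩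
  | feed h _ ih =>
    obtain ⟨c, rfl, hc⟩ := ih
    obtain ⟨j, h⟩ := h
    obtain ⟨a, j', rfl, h'⟩ := e.mem_src h
    exact ⟨a, rfl, .feed ⟨j', h'⟩ hc⟩

/-- Diagrams that differ only by discarded boxes have isomorphic normalizations. -/
lemma Hom.norm_iso {d d' : Diagram S u v} (e : Hom d d') : Iso d.norm d'.norm := by
  have key : ∀ (l : List (Place u d.label)) (l' : List (Place u d'.label)) h h'
      (_ : l' = l.map (Place.map e.box e.label_eq)),
      l'.pmap (Place.restrict (P := d'.Live)) h' = (l.pmap (Place.restrict (P := d.Live)) h).map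
        (Place.map (label' := d'.norm.label)
          (fun b : {b // d.Live b} => (⟨e.box b.1, e.live b.2⟩ : {b // d'.Live b}))
          fun b => e.label_eq b.1) := by
    intro l l' h h' hl
    apply List.map_injective_iff.2 (Place.map_injective (label := d'.norm.label)
      (label' := d'.label) Subtype.val (fun _ => rfl) Subtype.val_injective)
    erw [Place.map_pmap_restrict]
    rw [hl, List.map_map]
    conv_lhs => rw [← Place.map_pmap_restrict l h]
    rw [List.map_map]
    apply List.map_congr_left
    rintro (i | ⟨b, j⟩) _ <;> rfl
  refine ⟨⟨fun b => ⟨e.box b.1, e.live b.2⟩, fun a b h => ?_, fun b => e.label_eq b.1,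
    fun b => key _ _ _ _ (e.src_eq b.1), key _ _ _ _ e.out_eq⟩, fun a b h => ?_, fun b => ?_⟩
  · exact Subtype.ext (e.injective (congrArg Subtype.val h))
  · exact Subtype.ext (e.injective (congrArg Subtype.val h))
  · obtain ⟨a, ha, ha'⟩ := e.exists_live b.2
    exact ⟨⟨a, ha'⟩, Subtype.ext ha⟩


lemma out_length (d : Diagram S u v) : v.length = d.out.length := by
  conv_lhs => rw [← d.out_type, List.length_map]

lemma get_out_type (d : Diagram S u v) (i : Fin v.length) :
    (d.out.get (i.cast d.out_length)).type = v.get i := by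
  obtain ⟨i, hi⟩ := i
  have := List.getElem_of_eq d.out_type (i := i) (by simpa [← d.out_length] using hi)
  simpa using this

lemma map_sq {α β γ δ : Type*} {l : List α} {f : α → β} {g : β → δ} {f' : α → γ} {g' : γ → δ}
    (h : ∀ p, g (f p) = g' (f' p)) : (l.map f).map g = (l.map f').map g' := by
  rw [List.map_map, List.map_map]
  exact List.map_congr_left fun p _ => h p

lemma map_tri {α β γ δ : Type*} {l : List α} {f : α → β} {g : β → γ} {k : γ → δ} {m : α → δ}
    (h : ∀ p, k (g (f p)) = m p) : l.map m = ((l.map f).map g).map k := by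
  rw [List.map_map, List.map_map]
  exact List.map_congr_left fun p _ => (h p).symm

lemma map_self {α β : Type*} {l : List α} {f : α → β} {g : β → α}
    (h : ∀ p, g (f p) = p) : l = (l.map f).map g := by
  simp [List.map_map, Function.comp_def, h]

/-- The labelling of a diagram, as a morphism of hypergraphs to `S`. -/
def typing (d : Diagram S u v) : d.graph.Hom S where
  wire := Place.type
  box := d.label
  dom_box b := (d.src_type b).symm
  cod_box b := by
    change S.cod (d.label b) =
      ((List.finRange _).map fun j => (.inr ⟨b, j⟩ : Place u d.label)).map Place.type
    rw [List.map_map]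
    exact (List.map_get_finRange _).symm

section comp

variable (d : Diagram S u v) (d' : Diagram S v x)

/-- Wires of the first factor as wires of the composite. -/
def compLeft : Place u d.label → Place u (Sum.elim d.label d'.label)
  | .inl i => .inl i
  | .inr ⟨b, j⟩ => .inr ⟨.inl b, j⟩

/-- Wires of the second factor as wires of the composite: its inputs are glued to the outputs of
the first factor. -/
def compRight : Place v d'.label → Place u (Sum.elim d.label d'.label)
  | .inl i => compLeft d d' (d.out.get (i.cast d.out_length))
  | .inr ⟨b, j⟩ => .inr ⟨.inr b, j⟩

lemma type_compLeft (p) : (compLeft d d' p).type = p.type := by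
  obtain i | ⟨b, j⟩ := p <;> rfl

lemma type_compRight (p) : (compRight d d' p).type = p.type := by
  obtain i | ⟨b, j⟩ := p
  · rw [compRight, type_compLeft, get_out_type]; rfl
  · rfl

lemma inl_mem_compLeft {b j} {l : List (Place u d.label)}
    (h : .inr ⟨.inl b, j⟩ ∈ l.map (compLeft d d')) : .inr ⟨b, j⟩ ∈ l := by
  obtain ⟨i | ⟨a, j'⟩, hp, hq⟩ := List.mem_map.1 h
  · cases hq
  · cases hq; exact hp

lemma inr_not_mem_compLeft {b j} {l : List (Place u d.label)} :
    .inr ⟨.inr b, j⟩ ∉ l.map (compLeft d d') := by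
  rw [List.mem_map]
  rintro ⟨i | ⟨a, j'⟩, hp, hq⟩ <;> cases hq

lemma inr_mem_compRight {b j} {l : List (Place v d'.label)}
    (h : .inr ⟨.inr b, j⟩ ∈ l.map (compRight d d')) : .inr ⟨b, j⟩ ∈ l := by
  obtain ⟨i | ⟨a, j'⟩, hp, hq⟩ := List.mem_map.1 h
  · exact absurd (hq.subst (motive := (· ∈ d.out.map (compLeft d d')))
      (List.mem_map_of_mem (List.get_mem d.out (i.cast d.out_length)))) (inr_not_mem_compLeft d d')
  · cases hq; exact hp

lemma acyclic_of_sum {B B' : Type*} {r : B ⊕ B' → B ⊕ B' → Prop} {s : B → B → Prop}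
    {s' : B' → B' → Prop} (h : ∀ b, ¬ Relation.TransGen s b b)
    (h' : ∀ b, ¬ Relation.TransGen s' b b) (hr : ∀ p q, r p q → Sum.Lex s s' p q) (p : B ⊕ B') :
    ¬ Relation.TransGen r p p := by
  have key : ∀ p q, Relation.TransGen r p q →
      Sum.Lex (Relation.TransGen s) (Relation.TransGen s') p q := by
    intro p q hpq
    induction hpq with
    | single h => exact (hr _ _ h).mono (fun _ _ => Relation.TransGen.single) (fun _ _ => Relation.TransGen.single)
    | tail _ h ih =>
      exact Trans.trans ih ((hr _ _ h).mono (fun _ _ => Relation.TransGen.single) (fun _ _ => Relation.TransGen.single))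
  intro hp
  have := key p p hp
  cases this with
  | inl k => exact h _ k
  | inr k => exact h' _ k

/-- Sequential composition of diagrams (composition of cospans by pushout). -/
def comp : Diagram S u x where
  Box := d.Box ⊕ d'.Box
  finite := have := d.finite; have := d'.finite; inferInstance
  label := Sum.elim d.label d'.label
  src := Sum.elim (fun b => (d.src b).map (compLeft d d')) fun b => (d'.src b).map (compRight d d')
  out := d'.out.map (compRight d d')
  src_type := by
    rintro (b | b)
    · simp only [Sum.elim_inl, List.map_map, ← d.src_type]
      exact List.map_congr_left fun p _ => type_compLeft d d' p
    · simp only [Sum.elim_inr, List.map_map, ← d'.src_type]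
      exact List.map_congr_left fun p _ => type_compRight d d' p
  out_type := by
    rw [List.map_map]
    conv_rhs => rw [← d'.out_type]
    exact List.map_congr_left fun p _ => type_compRight d d' p
  acyclic := by
    apply acyclic_of_sum d.acyclic d'.acyclic
    rintro (b | b) (b' | b') ⟨j, h⟩
    · exact .inl ⟨j, inl_mem_compLeft d d' h⟩
    · exact .sep _ _
    · exact absurd h (inr_not_mem_compLeft d d')
    · exact .inr ⟨j, inr_mem_compRight d d' h⟩

end comp

lemma compLeft_map {d e : Diagram S u v} {d' e' : Diagram S v x} (f : Hom d e) (f' : Hom d' e')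
    (h) (p) : Place.map (Sum.map f.box f'.box) h (compLeft d d' p) =
      compLeft e e' (p.map f.box f.label_eq) := by
  obtain i | ⟨b, j⟩ := p <;> rfl

lemma compRight_map {d e : Diagram S u v} {d' e' : Diagram S v x} (f : Hom d e) (f' : Hom d' e')
    (h) (p) : Place.map (Sum.map f.box f'.box) h (compRight d d' p) =
      compRight e e' (p.map f'.box f'.label_eq) := by
  obtain i | ⟨b, j⟩ := p
  · change Place.map _ h (compLeft d d' (d.out.get _)) = compLeft e e' (e.out.get _)
    rw [compLeft_map]
    congr 1
    simp [f.out_eq]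
  · rfl

/-- Functoriality of `comp` for embeddings. -/
def Hom.compMap {d e : Diagram S u v} {d' e' : Diagram S v x} (f : Hom d e) (f' : Hom d' e') :
    Hom (d.comp d') (e.comp e') where
  box := Sum.map f.box f'.box
  injective := f.injective.sumMap f'.injective
  label_eq := by rintro (b | b); exacts [f.label_eq b, f'.label_eq b]
  src_eq := by
    rintro (b | b)
    · change (e.src (f.box b)).map (compLeft e e') = ((d.src b).map (compLeft d d')).map _
      rw [f.src_eq]
      exact map_sq fun p => (compLeft_map f f' _ p).symm
    · change (e'.src (f'.box b)).map (compRight e e') = ((d'.src b).map (compRight d d')).map _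
      rw [f'.src_eq]
      exact map_sq fun p => (compRight_map f f' _ p).symm
  out_eq := by
    change e'.out.map (compRight e e') = (d'.out.map (compRight d d')).map _
    rw [f'.out_eq]
    exact map_sq fun p => (compRight_map f f' _ p).symm

section assoc

variable {d : Diagram S u v} {d' : Diagram S v x} {d'' : Diagram S x y}

lemma compAssoc_left (h) (p) : Place.map (label' := (d.comp (d'.comp d'')).label)
    (Equiv.sumAssoc d.Box d'.Box d''.Box) h (compLeft (d.comp d') d'' (compLeft d d' p)) =
      compLeft d (d'.comp d'') p := by
  obtain i | ⟨b, j⟩ := p <;> rfl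

lemma compAssoc_mid (h) (p) : Place.map (label' := (d.comp (d'.comp d'')).label)
    (Equiv.sumAssoc d.Box d'.Box d''.Box) h (compLeft (d.comp d') d'' (compRight d d' p)) =
      compRight d (d'.comp d'') (compLeft d' d'' p) := by
  obtain i | ⟨b, j⟩ := p
  · exact compAssoc_left h _
  · rfl

lemma compAssoc_right (h) (p) : Place.map (label' := (d.comp (d'.comp d'')).label)
    (Equiv.sumAssoc d.Box d'.Box d''.Box) h (compRight (d.comp d') d'' p) =
      compRight d (d'.comp d'') (compRight d' d'' p) := by
  obtain i | ⟨b, j⟩ := p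
  · change Place.map _ h (compLeft (d.comp d') d'' ((d.comp d').out.get _)) =
      compRight d (d'.comp d'') (compLeft d' d'' (d'.out.get _))
    rw [← compAssoc_mid h]
    congr 2
    exact List.getElem_map _
  · rfl

end assoc

/-- Associativity of `comp`. -/
def compAssoc (d : Diagram S u v) (d' : Diagram S v x) (d'' : Diagram S x y) :
    Hom ((d.comp d').comp d'') (d.comp (d'.comp d'')) where
  box := Equiv.sumAssoc _ _ _
  injective := (Equiv.sumAssoc _ _ _).injective
  label_eq := by rintro ((b | b) | b) <;> rfl
  src_eq := by
    rintro ((b | b) | b)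
    · change (d.src b).map (compLeft d (d'.comp d'')) = ((((d.src b).map (compLeft d d')).map
        (compLeft (d.comp d') d''))).map _
      exact map_tri fun p => compAssoc_left _ p
    · change ((d'.src b).map (compLeft d' d'')).map (compRight d (d'.comp d'')) =
        ((((d'.src b).map (compRight d d')).map (compLeft (d.comp d') d''))).map _
      refine Eq.trans ?_ (map_tri fun p => compAssoc_mid _ p)
      exact List.map_map
    · change ((d''.src b).map (compRight d' d'')).map (compRight d (d'.comp d'')) =
        ((d''.src b).map (compRight (d.comp d') d'')).map _
      exact map_sq fun p => (compAssoc_right _ p).symm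
  out_eq := by
    change (d''.out.map (compRight d' d'')).map (compRight d (d'.comp d'')) =
        (d''.out.map (compRight (d.comp d') d'')).map _
    exact map_sq fun p => (compAssoc_right _ p).symm

/-- A diagram without boxes: its `k`-th output is the input `l[k]`. -/
def wiring (l : List (Fin u.length)) (h : l.map u.get = v) : Diagram S u v where
  Box := Empty
  finite := inferInstance
  label := Empty.elim
  src := fun b => b.elim
  out := l.map .inl
  src_type := fun b => b.elim
  out_type := by rw [List.map_map]; exact h
  acyclic := fun b => b.elim

/-- The identity diagram. -/
def id (u : List S.Wire) : Diagram S u u := wiring (List.finRange u.length) (by simp)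

lemma id_out_get (i : Fin u.length) (h) : (id u).out.get (i.cast h) = .inl i := by
  simp [id, wiring]
  rfl

lemma idComp_right {d : Diagram S u v} (h) (p : Place u d.label) :
    Place.map (label' := d.label) (Sum.elim (fun b : (id u).Box => b.elim) fun b => b) h
      (compRight (id u) d p) = p := by
  obtain i | ⟨b, j⟩ := p
  · exact congrArg (fun q => Place.map _ h (compLeft (id u) d q)) (id_out_get i _)
  · rfl

/-- Left unit law. -/
def idComp (d : Diagram S u v) : Hom ((id u).comp d) d where
  box := Sum.elim (fun b => b.elim) fun b => b
  injective := by
    rintro (b | b) (b' | b') h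
    exacts [b.elim, b.elim, b'.elim, congrArg _ h]
  label_eq := by rintro (b | b); exacts [b.elim, rfl]
  src_eq := by
    rintro (b | b)
    · exact b.elim
    · change d.src b = ((d.src b).map (compRight (id u) d)).map _
      exact map_self fun p => idComp_right _ p
  out_eq := by
    change d.out = (d.out.map (compRight (id u) d)).map _
    exact map_self fun p => idComp_right _ p

lemma compId_left {d : Diagram S u v} (h) (p : Place u d.label) :
    Place.map (label' := d.label) (Sum.elim (fun b => b) fun b : (id v).Box => b.elim) h
      (compLeft d (id v) p) = p := by
  obtain i | ⟨b, j⟩ := p <;> rfl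

/-- Right unit law. -/
def compId (d : Diagram S u v) : Hom (d.comp (id v)) d where
  box := Sum.elim (fun b => b) fun b => b.elim
  injective := by
    rintro (b | b) (b' | b') h
    exacts [congrArg _ h, b'.elim, b.elim, b.elim]
  label_eq := by rintro (b | b); exacts [rfl, b.elim]
  src_eq := by
    rintro (b | b)
    · change d.src b = ((d.src b).map (compLeft d (id v))).map _
      exact map_self fun p => compId_left _ p
    · exact b.elim
  out_eq := by
    change d.out = ((id v).out.map (compRight d (id v))).map _
    have h : d.out = (List.finRange v.length).map fun i => d.out.get (i.cast d.out_length) := by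
      apply List.ext_getElem
      · simp [d.out_length]
      · intros; simp
    exact h.trans (map_tri fun i => compId_left _ _)


section tensor

variable (d : Diagram S u v) (d' : Diagram S x y)

/-- Places of the left factor of `d ⊗ d'`. -/
def tensorLeft : Place u d.label → Place (u ++ x) (Sum.elim d.label d'.label)
  | .inl i => .inl ⟨i, by simp only [List.length_append]; omega⟩
  | .inr ⟨b, j⟩ => .inr ⟨.inl b, j⟩

/-- Places of the right factor of `d ⊗ d'`. -/
def tensorRight : Place x d'.label → Place (u ++ x) (Sum.elim d.label d'.label)
  | .inl i => .inl ⟨u.length + i, by simp only [List.length_append]; omega⟩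
  | .inr ⟨b, j⟩ => .inr ⟨.inr b, j⟩

lemma type_tensorLeft (p) : (tensorLeft d d' p).type = p.type := by
  obtain i | ⟨b, j⟩ := p
  · simp [tensorLeft, Place.type]
  · rfl

lemma type_tensorRight (p) : (tensorRight d d' p).type = p.type := by
  obtain i | ⟨b, j⟩ := p
  · simp [tensorRight, Place.type]
  · rfl

/-- Parallel composition of diagrams. -/
def tensor : Diagram S (u ++ x) (v ++ y) where
  Box := d.Box ⊕ d'.Box
  finite := have := d.finite; have := d'.finite; inferInstance
  label := Sum.elim d.label d'.label
  src := Sum.elim (fun b => (d.src b).map (tensorLeft d d'))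
    fun b => (d'.src b).map (tensorRight d d')
  out := d.out.map (tensorLeft d d') ++ d'.out.map (tensorRight d d')
  src_type := by
    rintro (b | b)
    · simp only [Sum.elim_inl, List.map_map, ← d.src_type]
      exact List.map_congr_left fun p _ => type_tensorLeft d d' p
    · simp only [Sum.elim_inr, List.map_map, ← d'.src_type]
      exact List.map_congr_left fun p _ => type_tensorRight d d' p
  out_type := by
    rw [List.map_append, List.map_map, List.map_map]
    conv_rhs => rw [← d.out_type, ← d'.out_type]
    exact congrArg₂ _ (List.map_congr_left fun p _ => type_tensorLeft d d' p)
      (List.map_congr_left fun p _ => type_tensorRight d d' p)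
  acyclic := by
    apply acyclic_of_sum d.acyclic d'.acyclic
    rintro (b | b) (b' | b') ⟨j, h⟩ <;> obtain ⟨i | ⟨a, j'⟩, hp, hq⟩ := List.mem_map.1 h <;> cases hq
    · exact .inl ⟨_, hp⟩
    · exact .inr ⟨_, hp⟩

variable {d d'}

lemma Normalized.tensor (h : d.Normalized) (h' : d'.Normalized) : (d.tensor d').Normalized := by
  rintro (b | b)
  · obtain ⟨j, hj | ⟨b', hb'⟩⟩ := h b
    · exact ⟨j, .inl (List.mem_append_left _
        (List.mem_map_of_mem (f := tensorLeft d d') hj))⟩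
    · exact ⟨j, .inr ⟨.inl b', List.mem_map_of_mem (f := tensorLeft d d') hb'⟩⟩
  · obtain ⟨j, hj | ⟨b', hb'⟩⟩ := h' b
    · exact ⟨j, .inl (List.mem_append_right _
        (List.mem_map_of_mem (f := tensorRight d d') hj))⟩
    · exact ⟨j, .inr ⟨.inr b', List.mem_map_of_mem (f := tensorRight d d') hb'⟩⟩

lemma tensorLeft_map {e : Diagram S u v} {e' : Diagram S x y} (f : Hom d e) (f' : Hom d' e')
    (h) (p) : Place.map (Sum.map f.box f'.box) h (tensorLeft d d' p) =
      tensorLeft e e' (p.map f.box f.label_eq) := by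
  obtain i | ⟨b, j⟩ := p <;> rfl

lemma tensorRight_map {e : Diagram S u v} {e' : Diagram S x y} (f : Hom d e) (f' : Hom d' e')
    (h) (p) : Place.map (Sum.map f.box f'.box) h (tensorRight d d' p) =
      tensorRight e e' (p.map f'.box f'.label_eq) := by
  obtain i | ⟨b, j⟩ := p <;> rfl

lemma Iso.tensor {e : Diagram S u v} {e' : Diagram S x y} (h : Iso d e) (h' : Iso d' e') :
    Iso (d.tensor d') (e.tensor e') := by
  obtain ⟨f, hf⟩ := h
  obtain ⟨f', hf'⟩ := h'
  refine ⟨⟨Sum.map f.box f'.box, f.injective.sumMap f'.injective, ?_, ?_, ?_⟩,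
    Sum.map_bijective.2 ⟨hf, hf'⟩⟩
  · rintro (b | b); exacts [f.label_eq b, f'.label_eq b]
  · rintro (b | b)
    · change (e.src (f.box b)).map (tensorLeft e e') = ((d.src b).map (tensorLeft d d')).map _
      rw [f.src_eq]
      exact map_sq fun p => (tensorLeft_map f f' _ p).symm
    · change (e'.src (f'.box b)).map (tensorRight e e') = ((d'.src b).map (tensorRight d d')).map _
      rw [f'.src_eq]
      exact map_sq fun p => (tensorRight_map f f' _ p).symm
  · change e.out.map (tensorLeft e e') ++ e'.out.map (tensorRight e e') =
      (d.out.map (tensorLeft d d') ++ d'.out.map (tensorRight d d')).map _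
    rw [f.out_eq, f'.out_eq]
    refine Eq.trans ?_ List.map_append.symm
    exact congrArg₂ _ (map_sq fun p => (tensorLeft_map f f' _ p).symm)
      (map_sq fun p => (tensorRight_map f f' _ p).symm)

end tensor

lemma Iso.comp {d e : Diagram S u v} {d' e' : Diagram S v x} (h : Iso d e) (h' : Iso d' e') :
    Iso (d.comp d').norm (e.comp e').norm := by
  obtain ⟨f, -⟩ := h
  obtain ⟨f', -⟩ := h'
  exact (f.compMap f').norm_iso

/-- The identity embedding. -/
noncomputable def Hom.refl (d : Diagram S u v) : Hom d d := (Iso.refl d).choose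

lemma wiring_normalized (l : List (Fin u.length)) (h : l.map u.get = v) :
    (wiring (S := S) l h).Normalized := fun b => b.elim

/-- The diagram consisting of the single box `b`. -/
def single (b : S.Box) : Diagram S (S.dom b) (S.cod b) where
  Box := Unit
  finite := inferInstance
  label _ := b
  src _ := (List.finRange _).map .inl
  out := (List.finRange _).map fun j => .inr ⟨(), j⟩
  src_type _ := by
    rw [List.map_map]
    exact List.map_get_finRange _
  out_type := by
    rw [List.map_map]
    exact List.map_get_finRange _
  acyclic b h := by
    obtain ⟨c, ⟨j, hj⟩, -⟩ := Relation.TransGen.head'_iff.1 h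
    obtain ⟨i, -, hi⟩ := List.mem_map.1 hj
    cases hi

end Diagram

lemma swap_type (u v : List S.Wire) :
    ((List.finRange v.length).map (fun i => (i.natAdd u.length).cast
        (List.length_append (as := u) (bs := v)).symm) ++
      (List.finRange u.length).map fun i => (i.castAdd v.length).cast
        (List.length_append (as := u) (bs := v)).symm).map (u ++ v).get = v ++ u := by
  rw [List.map_append, List.map_map, List.map_map]
  refine congrArg₂ _ (Eq.trans ?_ (List.map_get_finRange v))
    (Eq.trans ?_ (List.map_get_finRange u)) <;>
    exact List.map_congr_left fun i _ => by simp

/-- Objects of the free Markov category on `S`: finite words of wires of `S`. Morphisms are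
isomorphism classes of normalized diagrams; a composite is the composite diagram with all its
discarded boxes deleted. -/
structure FreeMarkov (S : Hypergraph.{w}) where
  of ::
  wires : List S.Wire

namespace FreeMarkov

/-- Isomorphism of normalized diagrams. -/
def setoid (u v : List S.Wire) : Setoid {d : Diagram S u v // d.Normalized} where
  r d d' := Diagram.Iso d.1 d'.1
  iseqv := ⟨fun d => .refl d.1, .symm, .trans⟩

instance : Category (FreeMarkov S) where
  Hom u v := Quotient (setoid u.wires v.wires)
  id u := Quotient.mk _ ⟨.id u.wires, Diagram.wiring_normalized _ _⟩
  comp := Quotient.map₂ (fun d d' => ⟨(d.1.comp d'.1).norm, Diagram.norm_normalized _⟩)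
    fun _ _ h _ _ h' => h.comp h'
  id_comp f := by
    induction f using Quotient.ind with
    | _ d => exact Quotient.sound (d.1.idComp.norm_iso.trans d.2.norm_iso)
  comp_id f := by
    induction f using Quotient.ind with
    | _ d => exact Quotient.sound (d.1.compId.norm_iso.trans d.2.norm_iso)
  assoc f g h := by
    induction f using Quotient.ind with | _ d =>
    induction g using Quotient.ind with | _ d' =>
    induction h using Quotient.ind with | _ d'' =>
    exact Quotient.sound <|
      ((Diagram.normIncl _).compMap (.refl d''.1)).norm_iso.trans <|
      (Diagram.compAssoc d.1 d'.1 d''.1).norm_iso.trans <|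
      ((Diagram.Hom.refl d.1).compMap (Diagram.normIncl _)).norm_iso.symm

/-- The monoidal unit: the empty word. -/
def unit : FreeMarkov S := of []

/-- Tensor product of objects: concatenation of words. -/
def tensorObj (u v : FreeMarkov S) : FreeMarkov S := of (u.wires ++ v.wires)

/-- Tensor product of morphisms: juxtaposition of diagrams. -/
def tensorHom {u v x y : FreeMarkov S} : (u ⟶ v) → (x ⟶ y) → (tensorObj u x ⟶ tensorObj v y) :=
  Quotient.map₂ (fun d d' => ⟨d.1.tensor d'.1, d.2.tensor d'.2⟩) fun _ _ h _ _ h' => h.tensor h'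

/-- The morphism given by a diagram without boxes. -/
def wiring {u v : FreeMarkov S} (l : List (Fin u.wires.length)) (h : l.map u.wires.get = v.wires) :
    u ⟶ v :=
  Quotient.mk _ ⟨.wiring l h, Diagram.wiring_normalized l h⟩

/-- The delete map. -/
def del (u : FreeMarkov S) : u ⟶ unit := wiring [] rfl

/-- The copy map. -/
def copy (u : FreeMarkov S) : u ⟶ tensorObj u u :=
  wiring (List.finRange _ ++ List.finRange _) (by simp [tensorObj])

/-- The swap `u ⊗ v ⟶ v ⊗ u`. -/
def swap (u v : FreeMarkov S) : tensorObj u v ⟶ tensorObj v u :=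
  wiring
    ((List.finRange v.wires.length).map (fun i => (i.natAdd u.wires.length).cast
        (List.length_append (as := u.wires) (bs := v.wires)).symm) ++
      (List.finRange u.wires.length).map fun i => (i.castAdd v.wires.length).cast
        (List.length_append (as := u.wires) (bs := v.wires)).symm)
    (swap_type u.wires v.wires)

/-- The morphism `⟨b⟩` given by a single box of the signature. (If `b` has no outputs, its box is a
discarded one, so that `⟨b⟩` is the delete map.) -/
def box (b : S.Box) : of (S.dom b) ⟶ of (S.cod b) :=
  Quotient.mk _ ⟨(Diagram.single b).norm, Diagram.norm_normalized _⟩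

/-- A generalized causal model: a string diagram whose right leg (from its outputs to its wires) is
one-to-one. -/
def IsCausalModel {u v : FreeMarkov S} (φ : u ⟶ v) : Prop :=
  ∃ d : {d : Diagram S u.wires v.wires // d.Normalized}, φ = Quotient.mk _ d ∧ d.1.out.Nodup

end FreeMarkov

end

/-! ### Joint factorizations and interventions -/

variable {S : Hypergraph.{w}} {M : Type u} [Category.{v} M] [MonoidalCategory M] [MarkovCategory M]

namespace Joint

/-- The class of a joint Markov kernel in `Joint M`. -/
def mk {Z X : Joint M} (a : JointKernel Z.obj X.obj) : Z ⟶ X := Quot.mk _ a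

/-- The morphism `([I, k], del)` of `Joint M` given by a deterministic morphism `k` of `M`. -/
def ofDet {Z X : Joint M} (k : Z.obj ⟶ X.obj) (hk : Deterministic k) : Z ⟶ X :=
  mk (.ofDet k hk)

/-- The monoidal unit. -/
def unit : Joint M := of (𝟙_ M)

/-- Tensor product of objects. -/
def tensorObj (X Y : Joint M) : Joint M := of (X.obj ⊗ Y.obj)

/-- Tensor product of morphisms. -/
def tensorHom {Z X W Y : Joint M} (f : Z ⟶ X) (g : W ⟶ Y) : tensorObj Z W ⟶ tensorObj X Y :=
  JointHom.tensor f g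

/-- The symmetry. -/
def swap (X Y : Joint M) : tensorObj X Y ⟶ tensorObj Y X :=
  ofDet (β_ X.obj Y.obj).hom (det_braiding _ _)

/-- The copy map. -/
def copy (X : Joint M) : X ⟶ tensorObj X X := ofDet (JointCausal.copy X.obj) (det_copy' _)

/-- The delete map. -/
def del (X : Joint M) : X ⟶ unit := ofDet (JointCausal.del X.obj) (det_del _)

/-- The morphism `([I, del ≫ x], del)` that discards its input and returns the deterministic
point `x`. -/
def const (Z : Joint M) {X : Joint M} (x : 𝟙_ M ⟶ X.obj) (hx : Deterministic x) : Z ⟶ X :=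
  ofDet (JointCausal.del Z.obj ≫ x) (det_comp (det_del _) hx)

end Joint

/-- A strict Markov functor from the free Markov category to `Joint M`: it strictly preserves the
unit, the tensor products of objects and morphisms, the symmetry, and the copy and delete maps. -/
structure IsStrictMarkov (F : FreeMarkov S ⥤ Joint M) : Prop where
  obj_unit : F.obj .unit = .unit
  obj_tensor (u v : FreeMarkov S) : F.obj (u.tensorObj v) = (F.obj u).tensorObj (F.obj v)
  map_tensor {u v x y : FreeMarkov S} (f : u ⟶ v) (g : x ⟶ y) :
    F.map (FreeMarkov.tensorHom f g) = eqToHom (obj_tensor u x) ≫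
      Joint.tensorHom (F.map f) (F.map g) ≫ eqToHom (obj_tensor v y).symm
  map_swap (u v : FreeMarkov S) : F.map (FreeMarkov.swap u v) = eqToHom (obj_tensor u v) ≫
    Joint.swap (F.obj u) (F.obj v) ≫ eqToHom (obj_tensor v u).symm
  map_copy (u : FreeMarkov S) :
    F.map (FreeMarkov.copy u) = Joint.copy (F.obj u) ≫ eqToHom (obj_tensor u u).symm
  map_del (u : FreeMarkov S) : F.map (FreeMarkov.del u) = Joint.del (F.obj u) ≫ eqToHom obj_unit.symm

variable (S M) in
/-- A joint factorization functor: a strict Markov functor `F` to `Joint M` and a labelling `r` of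
the boxes by words of residual wires, such that `F ⟨b⟩ = ([⨂ w ∈ r b, F w, k], f)` for some `k`
and `f`. (As `F` is strict, `⨂ w ∈ r b, F w` is the value of `F` at the word `r b`.) -/
structure JointFactorizationFunctor where
  F : FreeMarkov S ⥤ Joint M
  strict : IsStrictMarkov F
  r : S.Box → List S.Wire
  factors (b : S.Box) : ∃ a : JointKernel (F.obj (.of (S.dom b))).obj (F.obj (.of (S.cod b))).obj,
    a.res = (F.obj (.of (r b))).obj ∧ F.map (FreeMarkov.box b) = Joint.mk a

variable (S M) in
/-- A joint factorization `(f, φ, F)`: a joint factorization functor `F`, a generalized causal model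
`φ`, and a morphism `f` of `Joint M` with `f = F φ`. -/
structure JointFactorization extends JointFactorizationFunctor S M where
  dom : FreeMarkov S
  cod : FreeMarkov S
  φ : dom ⟶ cod
  causal : FreeMarkov.IsCausalModel φ
  f : F.obj dom ⟶ F.obj cod
  f_eq : f = F.map φ

/-- An intervention chooses for every box `b` either nothing or a deterministic point of the
codomain of `F ⟨b⟩`. -/
def Intervention (F : FreeMarkov S ⥤ Joint M) : Type _ :=
  ∀ b : S.Box, Option {x : 𝟙_ M ⟶ (F.obj (.of (S.cod b))).obj // Deterministic x}

/-- The interpretation of the box `b` under an intervention: the constant `x` if the intervention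
sets `b` to `x`, and `F ⟨b⟩` if it leaves `b` alone. -/
def Intervention.box {F : FreeMarkov S ⥤ Joint M} (act : Intervention F) (b : S.Box) :
    F.obj (.of (S.dom b)) ⟶ F.obj (.of (S.cod b)) :=
  match act b with
  | none => F.map (FreeMarkov.box b)
  | some x => Joint.const _ x.1 x.2

end JointCausal

/-!
# Interventions on joint factorizations

*Existence.* Evaluating diagrams box by box in `Joint M` is well defined only by a coherence
theorem for strict Markov categories, which can be avoided. The given functor `F` already carries
all the coherence that is needed, and it is reused as follows. As `S` has finitely many boxes, it
suffices to replace the value of `F` on one box `b₀` by a constant `X : 1 ⟶ F K` with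
`K = cod b₀`, and to iterate (`IsStrictMarkov.exists_do_box`, `IsStrictMarkov.exists_intervention`). For a
diagram `d : u ⟶ v`, let `cut d : K ⊗ u ⟶ v` be the diagram in which the boxes labelled `b₀` are
deleted and their outputs are replaced by `K` additional inputs, shared by all of these boxes. The
new functor sends `d` to

`F u ⟶ F (K ⊗ u) ⟶ F v`,

where the first map, `pad`, supplies `X`, and the second one is `F (cut d)`. Cutting a composite
or a juxtaposition amounts to cutting both parts and copying the inputs `K`
(`FreeMarkov.cut_comp`, `FreeMarkov.cut_tensor`), and since `X` is deterministic, supplying `X`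
and copying it is the same as supplying it twice (`IsStrictMarkov.pad_pad`,
`IsStrictMarkov.pad_tens_pad`). This gives functoriality and compatibility with tensor products.
Swaps, copies and deletions contain no box and are left alone. Diagrams are embedded into each
other, rather than shown isomorphic, wherever possible: an embedding that preserves the outputs
induces an isomorphism of the normalized diagrams, so that discarded boxes need no separate
treatment.

*Uniqueness.* Every morphism of the free Markov category is generated by copies, deletions and
boxes under composition and tensor products (`FreeMarkov.generated`). By acyclicity, a diagram
that has boxes has one that is fed by no other box; it can be evaluated first, and cutting it out
leaves a smaller diagram. A diagram without boxes is a tuple of projections. Hence a strict Markov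
functor is determined by its values on objects and boxes (`IsStrictMarkov.ext`).
-/

/-! ### Joint Markov kernels -/

namespace JointCausal

open CategoryTheory MonoidalCategory

universe u v w

section

variable {M : Type u} [Category.{v} M] [MonoidalCategory M] [MarkovCategory M]

lemma tensorμ_tensorμ (W X Y Z : M) : tensorμ W X Y Z ≫ tensorμ W Y X Z = 𝟙 _ := by
  simp only [tensorμ, Category.assoc, Iso.inv_hom_id_assoc]
  simp only [← MonoidalCategory.whiskerLeft_comp_assoc, Iso.hom_inv_id_assoc,
    ← comp_whiskerRight_assoc, SymmetricCategory.symmetry]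
  simp

lemma braiding_tensor_tensorμ (A B C D : M) : (β_ (A ⊗ B) (C ⊗ D)).hom ≫ tensorμ C D A B =
    tensorμ A B C D ≫ ((β_ A C).hom ⊗ₘ (β_ B D).hom) := by
  simp only [tensorμ, BraidedCategory.braiding_tensor_left_hom,
    BraidedCategory.braiding_tensor_right_hom]
  calc _ = 𝟙 _ ⊗≫ A ◁ (β_ B C).hom ▷ D ⊗≫ (β_ A C).hom ▷ (B ⊗ D) ⊗≫ (C ⊗ A) ◁ (β_ B D).hom ⊗≫
        C ◁ ((β_ A D).hom ≫ (β_ D A).hom) ▷ B ⊗≫ 𝟙 _ := by monoidal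
    _ = _ := by
      rw [SymmetricCategory.symmetry, MonoidalCategory.tensorHom_def]
      monoidal

lemma tensorμ_braiding (A B C D : M) : tensorμ A B C D ≫ (β_ (A ⊗ C) (B ⊗ D)).hom =
    ((β_ A B).hom ⊗ₘ (β_ C D).hom) ≫ tensorμ B A D C := by
  have h := braiding_tensor_tensorμ A C B D
  calc _ = tensorμ A B C D ≫ ((β_ (A ⊗ C) (B ⊗ D)).hom ≫ tensorμ B D A C) ≫ tensorμ B A D C := by
        rw [Category.assoc, tensorμ_tensorμ, Category.comp_id]
    _ = _ := by rw [h, Category.assoc, reassoc_of% (tensorμ_tensorμ A B C D)]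

lemma jointly_comp {Z N X Y : M} (f : Z ⟶ N) (k : N ⊗ Z ⟶ X) (g : X ⟶ Y) :
    jointly f (k ≫ g) = jointly f k ≫ N ◁ g := by
  simp [jointly]

/-- The joint of two parallel kernels is the tensor product of their joints, rearranged. -/
lemma jointly_tensor {Z N X W N' Y : M} (f : Z ⟶ N) (k : N ⊗ Z ⟶ X) (g : W ⟶ N')
    (l : N' ⊗ W ⟶ Y) :
    jointly (f ⊗ₘ g) (tensorμ N N' Z W ≫ (k ⊗ₘ l)) ≫ tensorμ N N' X Y =
      jointly f k ⊗ₘ jointly g l := by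
  have h1 := tensor_associativity N N' N N' Z W
  have h2 : (f ⊗ₘ g) ≫ copy (N ⊗ N') =
      ((f ≫ copy N) ⊗ₘ (g ≫ copy N')) ≫ tensorμ N N N' N' := by
    rw [copy_tensor, tensorHom_comp_tensorHom_assoc]
  simp only [jointly, Category.assoc, MonoidalCategory.whiskerLeft_comp]
  rw [tensorμ_natural_right, ← reassoc_of% h1, h2, comp_whiskerRight_assoc,
    ← comp_whiskerRight_assoc (tensorμ N N N' N'), tensorμ_tensorμ, id_whiskerRight,
    Category.id_comp, tensorμ_natural_left_assoc, copy_tensor, Category.assoc,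
    reassoc_of% (tensorμ_tensorμ Z Z W W)]
  simp only [tensorHom_comp_tensorHom]

lemma hom_unit_ext {X : M} (f g : X ⟶ 𝟙_ M) : f = g := by
  have h : ∀ f : X ⟶ 𝟙_ M, f = del X := fun f => by
    rw [← comp_del f, del_unit, Category.comp_id]
  rw [h f, h g]

/-! The laws of `Joint M` hold only up to reparametrization. In each of the following lemmas the
reparametrizing map of residuals is a structural isomorphism of `M`; composites with deterministic
morphisms are simplified first, to keep trivial residuals out of the computation. -/

namespace JointKernel

/-- Postcomposition with a deterministic morphism, without enlarging the residual. -/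
def postDet {Z X Y : M} (a : JointKernel Z X) (k : X ⟶ Y) (hk : Deterministic k) :
    JointKernel Z Y where
  res := a.res
  mech := a.mech ≫ k
  det := det_comp a.det hk
  noise := a.noise

/-- Precomposition with a deterministic morphism, without enlarging the residual. -/
def preDet {Z X Y : M} (k : Z ⟶ X) (hk : Deterministic k) (a : JointKernel X Y) :
    JointKernel Z Y where
  res := a.res
  mech := a.res ◁ k ≫ a.mech
  det := det_comp (det_whiskerLeft hk _) a.det
  noise := k ≫ a.noise

lemma comp_ofDet_reparam {Z X Y : M} (a : JointKernel Z X) (k : X ⟶ Y) (hk : Deterministic k) :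
    Reparam (a.comp (ofDet k hk)) (a.postDet k hk) := by
  refine ⟨(ρ_ a.res).hom, det_rightUnitor _, ?_, ?_⟩
  · simp only [comp, ofDet, postDet, Category.assoc, jointly_del]
  · simp only [comp, ofDet, postDet, leftUnitor_naturality_assoc]
    rw [← braiding_leftUnitor]
    monoidal

lemma ofDet_comp_reparam {Z X Y : M} (k : Z ⟶ X) (hk : Deterministic k) (a : JointKernel X Y) :
    Reparam ((ofDet k hk).comp a) (a.preDet k hk) := by
  refine ⟨(λ_ a.res).hom, det_leftUnitor _, ?_, ?_⟩
  · simp only [comp, ofDet, preDet, Category.assoc, leftUnitor_naturality, jointly_comp]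
    rw [leftUnitor_naturality_assoc, reassoc_of% (jointly_id Z)]
  · simp only [comp, ofDet, preDet, MonoidalCategory.whiskerLeft_comp, Category.assoc,
      triangle_assoc, ← comp_whiskerRight_assoc, braiding_rightUnitor]

lemma tensor_comp_reparam {Z X Y Z' X' Y' : M} (a : JointKernel Z X) (b : JointKernel Z' X')
    (a' : JointKernel X Y) (b' : JointKernel X' Y') :
    Reparam ((a.tensor b).comp (a'.tensor b')) ((a.comp a').tensor (b.comp b')) := by
  refine ⟨tensorμ _ _ _ _, det_tensorμ _ _ _ _, ?_, ?_⟩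
  · simp only [comp, tensor, Category.assoc]
    rw [tensorμ_natural_right, reassoc_of% (jointly_tensor a.noise a.mech b.noise b.mech),
      tensorHom_comp_tensorHom]
  · have h1 := tensor_associativity a'.res b'.res a.res b.res Z Z'
    simp only [comp, tensor, MonoidalCategory.whiskerLeft_comp, Category.assoc]
    rw [tensorμ_natural_right_assoc, ← reassoc_of% h1, ← comp_whiskerRight_assoc,
      braiding_tensor_tensorμ, comp_whiskerRight_assoc, tensorμ_natural_left_assoc]
    simp only [tensorHom_comp_tensorHom]

lemma ofDet_tensor_reparam {Z X W Y : M} (k : Z ⟶ X) (hk : Deterministic k) (l : W ⟶ Y)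
    (hl : Deterministic l) :
    Reparam ((ofDet k hk).tensor (ofDet l hl)) (ofDet (k ⊗ₘ l) (det_tensor hk hl)) := by
  refine ⟨(λ_ (𝟙_ M)).hom, det_leftUnitor _, hom_unit_ext _ _, ?_⟩
  simp only [tensor, ofDet]
  rw [← tensorHom_comp_tensorHom, tensor_left_unitality, Category.assoc, Category.assoc,
    ← comp_whiskerRight_assoc, Iso.hom_inv_id, id_whiskerRight, Category.id_comp]

lemma tensor_assoc_reparam {Z X Z' X' Z'' X'' : M} (a : JointKernel Z X) (b : JointKernel Z' X')
    (c : JointKernel Z'' X'') :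
    Reparam (((a.tensor b).tensor c).postDet (α_ X X' X'').hom (det_assoc _ _ _))
      (preDet (α_ Z Z' Z'').hom (det_assoc _ _ _) (a.tensor (b.tensor c))) := by
  refine ⟨(α_ _ _ _).hom, det_assoc _ _ _, by simp [tensor, preDet, postDet], ?_⟩
  have h := associator_monoidal a.res b.res c.res Z Z' Z''
  simp only [tensor, preDet, postDet, Category.assoc]
  calc _ = ((α_ a.res b.res c.res).hom ⊗ₘ (α_ Z Z' Z'').hom) ≫ tensorμ _ _ _ _ ≫
        (a.res ⊗ Z) ◁ tensorμ b.res c.res Z' Z'' ≫ (a.mech ⊗ₘ b.mech ⊗ₘ c.mech) := by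
        rw [MonoidalCategory.tensorHom_def (α_ a.res b.res c.res).hom, Category.assoc,
          ← id_tensorHom, ← id_tensorHom, tensorHom_comp_tensorHom, Category.id_comp]
    _ = _ := by
        rw [← reassoc_of% h, ← associator_naturality, ← tensorHom_id,
          tensorHom_comp_tensorHom_assoc, Category.id_comp]

lemma unit_tensor_reparam {Z X : M} (a : JointKernel Z X) :
    Reparam (((ofDet (𝟙 (𝟙_ M)) (det_id _)).tensor a).postDet (λ_ X).hom (det_leftUnitor X))
      (preDet (λ_ Z).hom (det_leftUnitor Z) a) := by
  refine ⟨(λ_ _).hom, det_leftUnitor _, ?_, ?_⟩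
  · simp [tensor, preDet, postDet, ofDet, del_unit]
  · have h := leftUnitor_monoidal a.res Z
    simp only [tensor, preDet, postDet, ofDet, Category.comp_id, Category.assoc]
    rw [← MonoidalCategory.tensorHom_def_assoc, h, Category.assoc, Category.assoc,
      ← leftUnitor_naturality, MonoidalCategory.tensorHom_def, Category.assoc]

lemma tensor_braiding_reparam {Z X W Y : M} (a : JointKernel Z X) (b : JointKernel W Y) :
    Reparam ((a.tensor b).postDet (β_ X Y).hom (det_braiding X Y))
      (preDet (β_ Z W).hom (det_braiding Z W) (b.tensor a)) := by
  refine ⟨(β_ _ _).hom, det_braiding _ _, ?_, ?_⟩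
  · simp [tensor, preDet, postDet]
  · simp only [tensor, preDet, postDet, Category.assoc]
    rw [BraidedCategory.braiding_naturality, reassoc_of% (tensorμ_braiding a.res b.res Z W),
      MonoidalCategory.tensorHom_def (β_ a.res b.res).hom, Category.assoc]

/-- Kernels into the unit are reparametrized to the trivial one by deleting the residual. -/
lemma reparam_del {Z : M} (a : JointKernel Z (𝟙_ M)) : Reparam a (ofDet (del Z) (det_del Z)) :=
  ⟨del _, det_del _, comp_del _, hom_unit_ext _ _⟩

end JointKernel

namespace Joint

lemma sound {Z X : Joint M} {a b : JointKernel Z.obj X.obj} (h : a.Reparam b) : mk a = mk b :=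
  Quot.sound h

lemma mk_comp_ofDet {Z X Y : Joint M} (a : JointKernel Z.obj X.obj) (k : X.obj ⟶ Y.obj)
    (hk : Deterministic k) : mk a ≫ ofDet (X := Y) k hk = mk (a.postDet k hk) :=
  sound (a.comp_ofDet_reparam k hk)

lemma ofDet_comp_mk {Z X Y : Joint M} (k : Z.obj ⟶ X.obj) (hk : Deterministic k)
    (a : JointKernel X.obj Y.obj) : ofDet (X := X) k hk ≫ mk a = mk (a.preDet k hk) :=
  sound (a.ofDet_comp_reparam k hk)

lemma ofDet_comp_ofDet {Z X Y : Joint M} (k : Z.obj ⟶ X.obj) (hk : Deterministic k)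
    (l : X.obj ⟶ Y.obj) (hl : Deterministic l) :
    (ofDet k hk : Z ⟶ X) ≫ (ofDet l hl : X ⟶ Y) = ofDet (k ≫ l) (det_comp hk hl) := by
  refine (mk_comp_ofDet _ _ _).trans (congrArg mk ?_)
  simp [JointKernel.postDet, JointKernel.ofDet]

lemma ofDet_id (Z : Joint M) : ofDet (𝟙 Z.obj) (det_id _) = 𝟙 Z := rfl

lemma tensorHom_ofDet {Z X W Y : Joint M} (k : Z.obj ⟶ X.obj) (hk : Deterministic k)
    (l : W.obj ⟶ Y.obj) (hl : Deterministic l) :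
    tensorHom (ofDet k hk : Z ⟶ X) (ofDet l hl : W ⟶ Y) = ofDet (k ⊗ₘ l) (det_tensor hk hl) :=
  sound (JointKernel.ofDet_tensor_reparam k hk l hl)

lemma tensorHom_id (Z W : Joint M) : tensorHom (𝟙 Z) (𝟙 W) = 𝟙 (tensorObj Z W) := by
  rw [← ofDet_id, ← ofDet_id, tensorHom_ofDet, ← ofDet_id]
  congr 1
  exact id_tensorHom_id _ _

lemma tensorHom_comp {Z X Y Z' X' Y' : Joint M} (f : Z ⟶ X) (f' : X ⟶ Y) (g : Z' ⟶ X')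
    (g' : X' ⟶ Y') : tensorHom (f ≫ f') (g ≫ g') = tensorHom f g ≫ tensorHom f' g' := by
  induction f using Quot.ind
  induction f' using Quot.ind
  induction g using Quot.ind
  induction g' using Quot.ind
  exact (sound (JointKernel.tensor_comp_reparam _ _ _ _)).symm

lemma tensorHom_assoc {Z X Z' X' Z'' X'' : Joint M} (f : Z ⟶ X) (g : Z' ⟶ X') (h : Z'' ⟶ X'') :
    tensorHom (tensorHom f g) h ≫ (ofDet (α_ X.obj X'.obj X''.obj).hom (det_assoc _ _ _) :
        tensorObj (tensorObj X X') X'' ⟶ tensorObj X (tensorObj X' X'')) =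
      (ofDet (α_ Z.obj Z'.obj Z''.obj).hom (det_assoc _ _ _) :
        tensorObj (tensorObj Z Z') Z'' ⟶ tensorObj Z (tensorObj Z' Z'')) ≫
        tensorHom f (tensorHom g h) := by
  induction f using Quot.ind
  induction g using Quot.ind
  induction h using Quot.ind
  exact (mk_comp_ofDet _ _ _).trans ((sound (JointKernel.tensor_assoc_reparam _ _ _)).trans
    (ofDet_comp_mk _ _ _).symm)

lemma unit_tensorHom {Z X : Joint M} (f : Z ⟶ X) :
    tensorHom (𝟙 unit) f ≫ (ofDet (λ_ X.obj).hom (det_leftUnitor _) : tensorObj unit X ⟶ X) =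
      (ofDet (λ_ Z.obj).hom (det_leftUnitor _) : tensorObj unit Z ⟶ Z) ≫ f := by
  induction f using Quot.ind
  exact (mk_comp_ofDet _ _ _).trans ((sound (JointKernel.unit_tensor_reparam _)).trans
    (ofDet_comp_mk _ _ _).symm)

lemma tensorHom_swap {Z X W Y : Joint M} (f : Z ⟶ X) (g : W ⟶ Y) :
    tensorHom f g ≫ swap X Y = swap Z W ≫ tensorHom g f := by
  induction f using Quot.ind
  induction g using Quot.ind
  exact (mk_comp_ofDet _ _ _).trans ((sound (JointKernel.tensor_braiding_reparam _ _)).trans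
    (ofDet_comp_mk _ _ _).symm)

lemma eq_del {Z : Joint M} (f : Z ⟶ unit) : f = del Z := by
  induction f using Quot.ind
  exact sound (JointKernel.reparam_del _)

lemma ofDet_eqToHom {Z X : Joint M} (h : Z.obj = X.obj) (hd) :
    (ofDet (eqToHom h) hd : Z ⟶ X) = eqToHom (congrArg of h) := by
  obtain ⟨Z⟩ := Z
  obtain ⟨X⟩ := X
  dsimp at h
  subst h
  rfl

end Joint

end
end JointCausal

/-! ### Diagrams without boxes -/

namespace JointCausal

open CategoryTheory MonoidalCategory

universe u v w

variable {S : Hypergraph.{w}}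

lemma Diagram.comp_out_getElem {u v x : List S.Wire} (d : Diagram S u v) (d' : Diagram S v x)
    (i : ℕ) (hi : i < (d.comp d').out.length) (hi' : i < d'.out.length) :
    (d.comp d').out[i] = compRight d d' d'.out[i] :=
  List.getElem_map _

lemma Diagram.tensor_out_getElem_left {u v x y : List S.Wire} (d : Diagram S u v)
    (d' : Diagram S x y) (i : ℕ) (hi : i < (d.tensor d').out.length) (hi' : i < d.out.length) :
    (d.tensor d').out[i] = tensorLeft d d' d.out[i] :=
  (List.getElem_append_left (hi'.trans_eq (List.length_map _).symm)).trans (List.getElem_map _)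

lemma Diagram.tensor_out_getElem_right {u v x y : List S.Wire} (d : Diagram S u v)
    (d' : Diagram S x y) (i : ℕ) (hi : i < (d.tensor d').out.length) (h : v.length ≤ i)
    (hi' : i - v.length < d'.out.length) :
    (d.tensor d').out[i] = tensorRight d d' d'.out[i - v.length] := by
  have key {α β γ : Type} (l : List α) (l' : List β) (f : α → γ) (g : β → γ) (n : ℕ)
      (hn : n = l.length) (h : n ≤ i) (hi : i < (l.map f ++ l'.map g).length)
      (hi' : i - n < l'.length) : (l.map f ++ l'.map g)[i] = g l'[i - n] := by
    subst hn
    rw [List.getElem_append_right (by simpa using h)]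
    simp
  exact key _ _ _ _ _ d.out_length h hi hi'

namespace FreeMarkov

variable {u v x y : List S.Wire}

/-- The morphism represented by an arbitrary diagram: the class of its normalization. -/
def ofDiagram (d : Diagram S u v) : of u ⟶ of v := Quotient.mk _ ⟨d.norm, d.norm_normalized⟩

lemma mk_eq_ofDiagram (d : {d : Diagram S u v // d.Normalized}) :
    (Quotient.mk _ d : of u ⟶ of v) = ofDiagram d.1 :=
  Quotient.sound d.2.norm_iso.symm

lemma exists_ofDiagram (f : of u ⟶ of v) : ∃ d : Diagram S u v, f = ofDiagram d := by
  induction f using Quotient.ind with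
  | _ d => exact ⟨d.1, mk_eq_ofDiagram d⟩

/-- An embedding of diagrams that preserves the outputs misses only boxes that are deleted by
normalization. -/
lemma ofDiagram_eq {d d' : Diagram S u v} (e : d.Hom d') : ofDiagram d = ofDiagram d' :=
  Quotient.sound e.norm_iso

lemma ofDiagram_comp (d : Diagram S u v) (d' : Diagram S v x) :
    ofDiagram (d.comp d') = ofDiagram d ≫ ofDiagram d' :=
  Quotient.sound (d.normIncl.compMap d'.normIncl).norm_iso.symm

/-- Functoriality of the juxtaposition of diagrams for embeddings. -/
def _root_.JointCausal.Diagram.Hom.tensorMap {d e : Diagram S u v} {d' e' : Diagram S x y}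
    (f : d.Hom e) (f' : d'.Hom e') : (d.tensor d').Hom (e.tensor e') where
  box := Sum.map f.box f'.box
  injective := f.injective.sumMap f'.injective
  label_eq := by rintro (b | b); exacts [f.label_eq b, f'.label_eq b]
  src_eq := by
    rintro (b | b)
    · change (e.src (f.box b)).map (Diagram.tensorLeft e e') =
        ((d.src b).map (Diagram.tensorLeft d d')).map _
      rw [f.src_eq]
      exact Diagram.map_sq fun p => (Diagram.tensorLeft_map f f' _ p).symm
    · change (e'.src (f'.box b)).map (Diagram.tensorRight e e') =
        ((d'.src b).map (Diagram.tensorRight d d')).map _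
      rw [f'.src_eq]
      exact Diagram.map_sq fun p => (Diagram.tensorRight_map f f' _ p).symm
  out_eq := by
    change e.out.map (Diagram.tensorLeft e e') ++ e'.out.map (Diagram.tensorRight e e') =
      (d.out.map (Diagram.tensorLeft d d') ++ d'.out.map (Diagram.tensorRight d d')).map _
    rw [f.out_eq, f'.out_eq]
    refine Eq.trans ?_ List.map_append.symm
    exact congrArg₂ _ (Diagram.map_sq fun p => (Diagram.tensorLeft_map f f' _ p).symm)
      (Diagram.map_sq fun p => (Diagram.tensorRight_map f f' _ p).symm)

lemma ofDiagram_tensor (d : Diagram S u v) (d' : Diagram S x y) :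
    ofDiagram (d.tensor d') = tensorHom (ofDiagram d) (ofDiagram d') := by
  refine (ofDiagram_eq (d.normIncl.tensorMap d'.normIncl)).symm.trans ?_
  exact (mk_eq_ofDiagram ⟨_, d.norm_normalized.tensor d'.norm_normalized⟩).symm

lemma wiring_eq_ofDiagram (l : List (Fin u.length)) (h : l.map u.get = v) :
    (wiring l h : of u ⟶ of v) = ofDiagram (.wiring l h) := mk_eq_ofDiagram _

lemma id_eq_ofDiagram (u : List S.Wire) : 𝟙 (of u) = ofDiagram (.id u) := mk_eq_ofDiagram ⟨_, _⟩

lemma box_eq_ofDiagram (b : S.Box) : box b = ofDiagram (.single b) := rfl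

/-- The wire at position `i` of `v` has the same type as the wire at position `f i` of `u`, for
every position `i` of `v`. -/
def Compat (u v : List S.Wire) (f : ℕ → ℕ) : Prop := ∀ i < v.length, u[f i]? = v[i]?

lemma Compat.lt {f : ℕ → ℕ} (h : Compat u v f) {i : ℕ} (hi : i < v.length) : f i < u.length := by
  have := h i hi
  rw [List.getElem?_eq_getElem hi] at this
  exact (List.getElem?_eq_some_iff.1 this).1

/-- The diagram without boxes whose `i`-th output is the input at position `f i`. -/
def rewireDiagram (u v : List S.Wire) (f : ℕ → ℕ) (h : Compat u v f) : Diagram S u v :=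
  .wiring (List.ofFn fun i : Fin v.length => ⟨f i, h.lt i.2⟩) <| by
    apply List.ext_getElem
    · simp
    · intro i h1 h2
      have := h i h2
      rw [List.getElem?_eq_getElem h2, List.getElem?_eq_getElem (h.lt h2)] at this
      simpa using this

/-- The morphism without boxes whose `i`-th output is the input at position `f i`. Positions are
natural numbers, and only the values of `f` below the length of `v` matter. -/
def rewire (u v : List S.Wire) (f : ℕ → ℕ) (h : Compat u v f) : of u ⟶ of v :=
  ofDiagram (rewireDiagram u v f h)

lemma rewireDiagram_getElem {f : ℕ → ℕ} (h : Compat u v f) (i : ℕ)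
    (hi : i < (rewireDiagram u v f h).out.length) :
    (rewireDiagram u v f h).out[i] =
      .inl ⟨f i, h.lt (by rwa [← (rewireDiagram u v f h).out_length] at hi)⟩ := by
  simp [rewireDiagram, Diagram.wiring]

/-- Diagrams without boxes are determined by the positions of their outputs among the inputs; the
identities between composites of structural maps thereby reduce to linear arithmetic. -/
lemma ofDiagram_eq_rewire {f : ℕ → ℕ} (h : Compat u v f) (d : Diagram S u v) (_ : IsEmpty d.Box)
    (hd : ∀ i (hi : i < d.out.length) (hi' : i < v.length), d.out[i] = .inl ⟨f i, h.lt hi'⟩) :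
    ofDiagram d = rewire u v f h := by
  refine (ofDiagram_eq (d := rewireDiagram u v f h)
    ⟨Empty.elim, fun b => b.elim, fun b => b.elim, fun b => b.elim, ?_⟩).symm
  apply List.ext_getElem
  · rw [List.length_map, ← d.out_length, ← (rewireDiagram u v f h).out_length]
  · intro i h1 h2
    rw [hd i h1 (by rwa [← d.out_length] at h1), List.getElem_map, rewireDiagram_getElem]
    rfl

lemma rewire_congr {f g : ℕ → ℕ} (h : Compat u v f) (h' : Compat u v g)
    (hfg : ∀ i < v.length, f i = g i) : rewire u v f h = rewire u v g h' :=
  ofDiagram_eq_rewire h' _ (inferInstanceAs (IsEmpty Empty)) fun i _ hi' => by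
    rw [rewireDiagram_getElem]
    simp [hfg i hi']

lemma Compat.comp {f g : ℕ → ℕ} (h : Compat u v f) (h' : Compat v x g) :
    Compat u x (fun i => f (g i)) := fun i hi => (h _ (h'.lt hi)).trans (h' i hi)

lemma rewire_comp {f g : ℕ → ℕ} (h : Compat u v f) (h' : Compat v x g) :
    rewire u v f h ≫ rewire v x g h' = rewire u x (fun i => f (g i)) (h.comp h') := by
  rw [rewire, rewire, ← ofDiagram_comp]
  refine ofDiagram_eq_rewire _ _ (inferInstanceAs (IsEmpty (Empty ⊕ Empty))) fun i hi hi' => ?_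
  have hl : i < (rewireDiagram v x g h').out.length := by rwa [← Diagram.out_length]
  refine (Diagram.comp_out_getElem _ _ i hi hl).trans ?_
  refine (congrArg _ (rewireDiagram_getElem h' i hl)).trans ?_
  exact congrArg (Diagram.compLeft _ _) (rewireDiagram_getElem h (g i) _)

lemma Compat.tensor {f g : ℕ → ℕ} (h : Compat u v f) (h' : Compat x y g) :
    Compat (u ++ x) (v ++ y)
      (fun i => if i < v.length then f i else u.length + g (i - v.length)) := by
  intro i hi
  rw [List.length_append] at hi
  dsimp only
  split_ifs with hv
  · rw [List.getElem?_append_left (h.lt hv), List.getElem?_append_left hv, h i hv]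
  · rw [List.getElem?_append_right (by omega), List.getElem?_append_right (by omega),
      Nat.add_sub_cancel_left, h' _ (by omega)]

lemma rewire_tensor {f g : ℕ → ℕ} (h : Compat u v f) (h' : Compat x y g) :
    tensorHom (rewire u v f h) (rewire x y g h') = rewire (u ++ x) (v ++ y) _ (h.tensor h') := by
  rw [rewire, rewire, ← ofDiagram_tensor]
  refine ofDiagram_eq_rewire _ _ (inferInstanceAs (IsEmpty (Empty ⊕ Empty))) fun i hi hi' => ?_
  rw [List.length_append] at hi'
  by_cases hv : i < v.length
  · refine (Diagram.tensor_out_getElem_left _ _ i hi (by rwa [← Diagram.out_length])).trans ?_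
    refine (congrArg _ (rewireDiagram_getElem h i _)).trans ?_
    simp only [if_pos hv]
    rfl
  · refine (Diagram.tensor_out_getElem_right _ _ i hi (by omega)
      (by rw [← Diagram.out_length]; omega)).trans ?_
    refine (congrArg _ (rewireDiagram_getElem h' _ _)).trans ?_
    simp only [if_neg hv]
    rfl

lemma Compat.id (u : List S.Wire) : Compat u u (fun i => i) := fun _ _ => rfl

lemma id_eq_rewire (u : List S.Wire) : 𝟙 (of u) = rewire u u (fun i => i) (.id u) := by
  rw [id_eq_ofDiagram]
  exact ofDiagram_eq_rewire _ _ (inferInstanceAs (IsEmpty Empty)) fun i hi hi' => by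
    simp [Diagram.id, Diagram.wiring]

lemma Compat.of_eq (h : u = v) : Compat u v (fun i => i) := fun _ _ => by rw [h]

lemma eqToHom_eq_rewire (h : (of u : FreeMarkov S) = of v) :
    eqToHom h = rewire u v (fun i => i) (.of_eq (congrArg wires h)) := by
  obtain rfl : u = v := congrArg wires h
  exact id_eq_rewire u

lemma Compat.nil (f : ℕ → ℕ) : Compat u [] f := fun _ hi => absurd hi (by simp)

lemma del_eq_rewire (u : List S.Wire) (f : ℕ → ℕ) : del (of u) = rewire u [] f (.nil f) := by
  refine (wiring_eq_ofDiagram (u := u) (v := []) _ _).trans ?_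
  exact ofDiagram_eq_rewire _ _ (inferInstanceAs (IsEmpty Empty)) fun i hi hi' => by
    simp at hi'

lemma Compat.copy (u : List S.Wire) :
    Compat u (u ++ u) (fun i => if i < u.length then i else i - u.length) := by
  intro i hi
  rw [List.length_append] at hi
  dsimp only
  split_ifs with hv
  · rw [List.getElem?_append_left hv]
  · rw [List.getElem?_append_right (by omega)]

lemma copy_eq_rewire (u : List S.Wire) : copy (of u) = rewire u (u ++ u) _ (.copy u) := by
  refine (wiring_eq_ofDiagram (u := u) (v := u ++ u) _ _).trans ?_
  exact ofDiagram_eq_rewire _ _ (inferInstanceAs (IsEmpty Empty)) fun i hi hi' => by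
    simp only [Diagram.wiring, List.getElem_map, List.getElem_append]
    simp only [List.length_finRange]
    split_ifs <;> simp

lemma Compat.swap (u v : List S.Wire) :
    Compat (u ++ v) (v ++ u) (fun i => if i < v.length then u.length + i else i - v.length) := by
  intro i hi
  rw [List.length_append] at hi
  dsimp only
  split_ifs with hv
  · rw [List.getElem?_append_right (by omega), List.getElem?_append_left hv,
      Nat.add_sub_cancel_left]
  · rw [List.getElem?_append_left (by omega), List.getElem?_append_right (by omega)]

lemma swap_eq_rewire (u v : List S.Wire) :
    swap (of u) (of v) = rewire (u ++ v) (v ++ u) _ (.swap u v) := by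
  refine (wiring_eq_ofDiagram (u := u ++ v) (v := v ++ u) _ _).trans ?_
  exact ofDiagram_eq_rewire _ _ (inferInstanceAs (IsEmpty Empty)) fun i hi hi' => by
    simp only [Diagram.wiring, List.getElem_map, List.getElem_append]
    simp only [List.length_map, List.length_finRange]
    split_ifs <;> simp

lemma swap_swap (u v : List S.Wire) : swap (of u) (of v) ≫ swap (of v) (of u) = 𝟙 _ := by
  refine (congrArg₂ _ (swap_eq_rewire u v) (swap_eq_rewire v u)).trans ?_
  refine (rewire_comp _ _).trans (Eq.trans ?_ (id_eq_rewire (u ++ v)).symm)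
  refine rewire_congr _ _ fun i hi => ?_
  simp only [List.length_append] at hi
  split_ifs <;> omega

end FreeMarkov

end JointCausal

/-! ### Strict Markov functors and points that can be copied -/

namespace JointCausal

open CategoryTheory MonoidalCategory

universe u v w

variable {S : Hypergraph.{w}} {M : Type u} [Category.{v} M] [MonoidalCategory M] [MarkovCategory M]

namespace Joint

lemma tensorHom_conj_left {Z Z' X X' W Y : Joint M} (h : Z' = Z) (h' : X = X') (f : Z ⟶ X)
    (g : W ⟶ Y) : tensorHom (eqToHom h ≫ f ≫ eqToHom h') g =
      eqToHom (congrArg (tensorObj · W) h) ≫ tensorHom f g ≫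
        eqToHom (congrArg (tensorObj · Y) h') := by
  subst h h'
  simp

lemma tensorHom_conj_right {Z Z' X X' W Y : Joint M} (h : Z' = Z) (h' : X = X') (f : Z ⟶ X)
    (g : W ⟶ Y) : tensorHom g (eqToHom h ≫ f ≫ eqToHom h') =
      eqToHom (congrArg (tensorObj W) h) ≫ tensorHom g f ≫
        eqToHom (congrArg (tensorObj Y) h') := by
  subst h h'
  simp

lemma hom_ext_of_eq_unit {A B : Joint M} (h : B = unit) (f g : A ⟶ B) : f = g := by
  subst h
  rw [eq_del f, eq_del g]

variable [IsStrictMonoidal M]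

lemma tensorObj_assoc (X Y Z : Joint M) :
    tensorObj (tensorObj X Y) Z = tensorObj X (tensorObj Y Z) :=
  congrArg of (IsStrictMonoidal.tensor_assoc _ _ _)

lemma unit_tensorObj (X : Joint M) : tensorObj unit X = X :=
  congrArg of (IsStrictMonoidal.unit_tensor _)

lemma ofDet_associator (X Y Z : Joint M) :
    (ofDet (α_ X.obj Y.obj Z.obj).hom (det_assoc _ _ _) :
      tensorObj (tensorObj X Y) Z ⟶ tensorObj X (tensorObj Y Z)) =
      eqToHom (tensorObj_assoc X Y Z) := by
  simp only [IsStrictMonoidal.associator_hom]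
  exact ofDet_eqToHom _ _

lemma ofDet_leftUnitor (X : Joint M) :
    (ofDet (λ_ X.obj).hom (det_leftUnitor _) : tensorObj unit X ⟶ X) =
      eqToHom (unit_tensorObj X) := by
  simp only [IsStrictMonoidal.leftUnitor_hom]
  exact ofDet_eqToHom _ _

/-- In `Joint M` the tensor product is strictly associative, as it is in `M`. -/
lemma tensorHom_assoc_eq {Z X Z' X' Z'' X'' : Joint M} (f : Z ⟶ X) (g : Z' ⟶ X') (h : Z'' ⟶ X'') :
    tensorHom (tensorHom f g) h = eqToHom (tensorObj_assoc _ _ _) ≫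
      tensorHom f (tensorHom g h) ≫ eqToHom (tensorObj_assoc _ _ _).symm := by
  have := tensorHom_assoc f g h
  rw [ofDet_associator, ofDet_associator] at this
  rw [← reassoc_of% this]
  simp

lemma unit_tensorHom_eq {A Z X : Joint M} (hA : A = unit) (f : Z ⟶ X) :
    tensorHom (𝟙 A) f =
      eqToHom ((congrArg (tensorObj · Z) hA).trans (unit_tensorObj Z)) ≫ f ≫
      eqToHom ((congrArg (tensorObj · X) hA).trans (unit_tensorObj X)).symm := by
  subst hA
  have := unit_tensorHom f
  rw [ofDet_leftUnitor, ofDet_leftUnitor] at this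
  rw [← reassoc_of% this]
  simp

end Joint

namespace IsStrictMarkov

variable {F : FreeMarkov S ⥤ Joint M} (hF : IsStrictMarkov F) {u v x y u' v' x' : FreeMarkov S}

lemma hom_unit_ext (hF : IsStrictMarkov F) {A : Joint M} (f g : A ⟶ F.obj .unit) : f = g :=
  Joint.hom_ext_of_eq_unit hF.obj_unit f g

/-- The tensor product of morphisms between values of a strict Markov functor `F`, again as a
morphism between values of `F`. -/
def tens (f : F.obj u ⟶ F.obj v) (g : F.obj x ⟶ F.obj y) :
    F.obj (u.tensorObj x) ⟶ F.obj (v.tensorObj y) :=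
  eqToHom (hF.obj_tensor u x) ≫ Joint.tensorHom f g ≫ eqToHom (hF.obj_tensor v y).symm

lemma map_tens (f : u ⟶ v) (g : x ⟶ y) :
    F.map (FreeMarkov.tensorHom f g) = hF.tens (F.map f) (F.map g) := hF.map_tensor f g

lemma tens_comp (f : F.obj u ⟶ F.obj v) (f' : F.obj v ⟶ F.obj u') (g : F.obj x ⟶ F.obj y)
    (g' : F.obj y ⟶ F.obj x') :
    hF.tens (f ≫ f') (g ≫ g') = hF.tens f g ≫ hF.tens f' g' := by
  simp [tens, Joint.tensorHom_comp]

lemma tens_id (u v : FreeMarkov S) : hF.tens (𝟙 (F.obj u)) (𝟙 (F.obj v)) = 𝟙 _ := by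
  simp [tens, Joint.tensorHom_id]

lemma tens_swap (f : F.obj u ⟶ F.obj v) (g : F.obj x ⟶ F.obj y) :
    hF.tens f g ≫ F.map (FreeMarkov.swap v y) = F.map (FreeMarkov.swap u x) ≫ hF.tens g f := by
  simp only [tens, hF.map_swap, Category.assoc, eqToHom_trans_assoc, eqToHom_refl,
    Category.id_comp]
  rw [reassoc_of% (Joint.tensorHom_swap f g)]

lemma tensorObj_assoc (u v x : FreeMarkov S) :
    (u.tensorObj v).tensorObj x = u.tensorObj (v.tensorObj x) :=
  congrArg FreeMarkov.of (List.append_assoc _ _ _)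

variable [IsStrictMonoidal M]

lemma tens_assoc (f : F.obj u ⟶ F.obj u') (g : F.obj v ⟶ F.obj v') (h : F.obj x ⟶ F.obj x') :
    hF.tens (hF.tens f g) h = eqToHom (congrArg F.obj (tensorObj_assoc u v x)) ≫
      hF.tens f (hF.tens g h) ≫ eqToHom (congrArg F.obj (tensorObj_assoc u' v' x')).symm := by
  simp only [tens, Joint.tensorHom_conj_left, Joint.tensorHom_conj_right, Category.assoc,
    Joint.tensorHom_assoc_eq, eqToHom_trans, eqToHom_trans_assoc]

lemma unit_tens (f : F.obj u ⟶ F.obj v) : hF.tens (𝟙 (F.obj .unit)) f = f := by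
  rw [tens, Joint.unit_tensorHom_eq hF.obj_unit]
  simp only [Category.assoc, eqToHom_trans, eqToHom_trans_assoc]
  exact (Category.id_comp _).trans (Category.comp_id _)

section pad

variable {K : FreeMarkov S} (X : F.obj .unit ⟶ F.obj K)

/-- Supply the point `X` on additional wires `K` to the left of `u`. -/
def pad (u : FreeMarkov S) : F.obj u ⟶ F.obj (K.tensorObj u) := hF.tens X (𝟙 (F.obj u))

/-- Both sides are the tensor product of `X` and `g`. -/
lemma pad_naturality (g : F.obj u ⟶ F.obj v) :
    hF.pad X u ≫ hF.tens (𝟙 (F.obj K)) g = g ≫ hF.pad X v := by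
  refine (hF.tens_comp _ _ _ _).symm.trans ?_
  conv_rhs => rw [← hF.unit_tens g]
  refine Eq.trans ?_ (hF.tens_comp _ _ _ _)
  rw [Category.id_comp, Category.comp_id, Category.id_comp, Category.comp_id]

lemma pad_tensorObj (u x : FreeMarkov S) :
    hF.pad X (u.tensorObj x) = hF.tens (hF.pad X u) (𝟙 (F.obj x)) ≫
      eqToHom (congrArg F.obj (tensorObj_assoc K u x)) := by
  have h : hF.tens (hF.pad X u) (𝟙 (F.obj x)) = 𝟙 _ ≫ hF.pad X (u.tensorObj x) ≫
      eqToHom (congrArg F.obj (tensorObj_assoc K u x)).symm := by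
    have h := hF.tens_assoc X (𝟙 (F.obj u)) (𝟙 (F.obj x))
    rw [tens_id] at h
    exact h
  rw [h]
  simp

lemma pad_tens_id {L : FreeMarkov S} (g : F.obj K ⟶ F.obj L) (u : FreeMarkov S) :
    hF.pad X u ≫ hF.tens g (𝟙 (F.obj u)) = hF.pad (X ≫ g) u := by
  refine (hF.tens_comp _ _ _ _).symm.trans ?_
  rw [Category.comp_id, pad]

/-- Duplicate the wires `K`. -/
def _root_.JointCausal.FreeMarkov.dup (K u : FreeMarkov S) :
    K.tensorObj u ⟶ K.tensorObj (K.tensorObj u) :=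
  FreeMarkov.tensorHom (FreeMarkov.copy K) (𝟙 u) ≫ eqToHom (tensorObj_assoc K K u)

/-- As the point `X` is copyable, supplying it twice amounts to supplying it once and copying. -/
lemma pad_pad (hX : X ≫ F.map (FreeMarkov.copy K) = hF.tens X X) (u : FreeMarkov S) :
    hF.pad X u ≫ hF.pad X (K.tensorObj u) = hF.pad X u ≫ F.map (FreeMarkov.dup K u) := by
  have h : X ≫ hF.pad X K = X ≫ F.map (FreeMarkov.copy K) := by
    rw [hX, ← pad_naturality, pad]
    refine (hF.tens_comp _ _ _ _).symm.trans ?_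
    rw [Category.comp_id, Category.id_comp]
  rw [pad_tensorObj, FreeMarkov.dup, F.map_comp, hF.map_tens, F.map_id, eqToHom_map,
    reassoc_of% (hF.pad_tens_id X (hF.pad X K) u), reassoc_of% (hF.pad_tens_id X (F.map _) u), h]

/-- The projection to the second factor. -/
def _root_.JointCausal.FreeMarkov.snd (K u : FreeMarkov S) : K.tensorObj u ⟶ u :=
  FreeMarkov.tensorHom (FreeMarkov.del K) (𝟙 u)

/-- The projection to the first factor. As the right unit law holds for words only up to equality of
objects, the unit is moved to the left. -/
def _root_.JointCausal.FreeMarkov.fst (K u : FreeMarkov S) : K.tensorObj u ⟶ K :=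
  FreeMarkov.tensorHom (𝟙 K) (FreeMarkov.del u) ≫ FreeMarkov.swap K .unit

lemma pad_snd (u : FreeMarkov S) : hF.pad X u ≫ F.map (FreeMarkov.snd K u) = 𝟙 (F.obj u) := by
  have h : hF.pad X u ≫ F.map (FreeMarkov.tensorHom (FreeMarkov.del K) (𝟙 u)) = 𝟙 (F.obj u) := by
    rw [hF.map_tens, F.map_id, pad_tens_id, hF.hom_unit_ext (X ≫ _) (𝟙 _), pad, tens_id]
    rfl
  exact h

lemma pad_fst (u : FreeMarkov S) :
    hF.pad X u ≫ F.map (FreeMarkov.fst K u) = F.map (FreeMarkov.del u) ≫ X := by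
  have h : hF.pad X .unit ≫ F.map (FreeMarkov.swap K .unit) = X := by
    refine (hF.tens_swap _ _).trans ?_
    rw [unit_tens]
    exact (congrArg (· ≫ X) (hF.hom_unit_ext _ (𝟙 _))).trans (Category.id_comp _)
  have h' : hF.pad X u ≫ F.map (FreeMarkov.tensorHom (𝟙 K) (FreeMarkov.del u) ≫
      FreeMarkov.swap K .unit) = F.map (FreeMarkov.del u) ≫ X := by
    rw [F.map_comp, hF.map_tens, F.map_id,
      reassoc_of% (hF.pad_naturality X (F.map (FreeMarkov.del u))), h]
    rfl
  exact h'

/-- The rearrangement of wires `K ⊗ (u ⊗ x) ⟶ (K ⊗ u) ⊗ (K ⊗ x)` that copies `K`. -/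
def _root_.JointCausal.FreeMarkov.share (K u x : FreeMarkov S) :
    K.tensorObj (u.tensorObj x) ⟶ (K.tensorObj u).tensorObj (K.tensorObj x) :=
  FreeMarkov.dup K (u.tensorObj x) ≫
    FreeMarkov.tensorHom (𝟙 K)
      (eqToHom (tensorObj_assoc K u x).symm ≫ FreeMarkov.swap (K.tensorObj u) x) ≫
    eqToHom (tensorObj_assoc K x (K.tensorObj u)).symm ≫
    FreeMarkov.swap (K.tensorObj x) (K.tensorObj u)

/-- Supplying `X` to both factors of a tensor product amounts to supplying it once and sharing it.
The second copy is moved past `u` by swaps, so that both copies are supplied on the left. -/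
lemma pad_tens_pad (hX : X ≫ F.map (FreeMarkov.copy K) = hF.tens X X) (u x : FreeMarkov S) :
    hF.tens (hF.pad X u) (hF.pad X x) =
      hF.pad X (u.tensorObj x) ≫ F.map (FreeMarkov.share K u x) := by
  have h1 : hF.tens (𝟙 (F.obj (K.tensorObj u))) (hF.pad X x) =
      F.map (FreeMarkov.swap (K.tensorObj u) x) ≫
        hF.tens (hF.pad X x) (𝟙 (F.obj (K.tensorObj u))) ≫
        F.map (FreeMarkov.swap (K.tensorObj x) (K.tensorObj u)) := by
    rw [tens_swap, ← Category.assoc, ← F.map_comp, FreeMarkov.swap_swap, F.map_id]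
    exact (Category.id_comp _).symm
  have h2 (u x) : hF.tens (hF.pad X u) (𝟙 (F.obj x)) = hF.pad X (u.tensorObj x) ≫
      F.map (eqToHom (tensorObj_assoc K u x).symm) := by
    rw [pad_tensorObj, eqToHom_map, Category.assoc, eqToHom_trans, eqToHom_refl, Category.comp_id]
  calc hF.tens (hF.pad X u) (hF.pad X x) = hF.tens (hF.pad X u) (𝟙 (F.obj x)) ≫
        hF.tens (𝟙 (F.obj (K.tensorObj u))) (hF.pad X x) := by
        rw [← tens_comp, Category.id_comp, Category.comp_id]
    _ = _ := by
        rw [h1, h2, h2 x, Category.assoc, Category.assoc, FreeMarkov.share, F.map_comp, F.map_comp,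
          F.map_comp, hF.map_tens, ← reassoc_of% (hF.pad_pad X hX (u.tensorObj x)), F.map_id,
          reassoc_of% (hF.pad_naturality X (F.map (eqToHom (tensorObj_assoc K u x).symm ≫
            FreeMarkov.swap (K.tensorObj u) x))), F.map_comp, Category.assoc]

end pad

end IsStrictMarkov

end JointCausal

/-! ### Cutting boxes out of diagrams -/

namespace JointCausal

open CategoryTheory MonoidalCategory

universe u v w

variable {S : Hypergraph.{w}} {u v x y : List S.Wire}

namespace Place

variable {B : Type} {label : B → S.Box} {b₀ : S.Box} {A : B → Prop}

open Classical in
/-- The action on wires of cutting the boxes in `A`, all of which are labelled `b₀`: their outputs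
become the first inputs, and the inputs `u` are shifted accordingly. -/
noncomputable def cut (hA : ∀ b, A b → label b = b₀) :
    Place u label → Place (S.cod b₀ ++ u) (fun b : {b // ¬ A b} => label b.1)
  | .inl i => .inl ⟨(S.cod b₀).length + i, by simp⟩
  | .inr ⟨b, j⟩ => if h : A b then .inl ⟨j, by have := j.2; simp [← hA b h]; omega⟩
      else .inr ⟨⟨b, h⟩, j⟩

lemma cut_inr_pos (hA : ∀ b, A b → label b = b₀) {b : B} (h : A b) (j) :
    cut (u := u) hA (.inr ⟨b, j⟩) =
      .inl ⟨j, by have := j.2; simp [← hA b h]; omega⟩ := dif_pos h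

lemma cut_inr_neg (hA : ∀ b, A b → label b = b₀) {b : B} (h : ¬ A b) (j) :
    cut (u := u) hA (.inr ⟨b, j⟩) = .inr ⟨⟨b, h⟩, j⟩ := dif_neg h

lemma type_cut (hA : ∀ b, A b → label b = b₀) (p : Place u label) : (cut hA p).type = p.type := by
  obtain i | ⟨b, j⟩ := p
  · simp [cut, type]
  · by_cases h : A b
    · obtain rfl := hA b h
      rw [cut_inr_pos hA h]
      simp [type]
    · rw [cut_inr_neg hA h]
      rfl

end Place

namespace Diagram

/-- Cut the boxes in `A`, all of which are labelled `b₀`, out of a diagram: these boxes are deleted,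
and their outputs are replaced by additional inputs of the diagram, which they all share. The set
`A` is a parameter, so that single boxes can be cut, too. -/
noncomputable def cut (d : Diagram S u v) (b₀ : S.Box) (A : d.Box → Prop)
    (hA : ∀ b, A b → d.label b = b₀) : Diagram S (S.cod b₀ ++ u) v where
  Box := {b // ¬ A b}
  finite := have := d.finite; inferInstance
  label b := d.label b.1
  src b := (d.src b.1).map (Place.cut hA)
  out := d.out.map (Place.cut hA)
  src_type b := by
    rw [List.map_map, ← d.src_type]
    exact List.map_congr_left fun p _ => Place.type_cut hA p
  out_type := by
    rw [List.map_map]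
    conv_rhs => rw [← d.out_type]
    exact List.map_congr_left fun p _ => Place.type_cut hA p
  acyclic b h := d.acyclic b.1 <| h.lift Subtype.val fun b b' ⟨j, hj⟩ => ⟨j, by
    obtain ⟨i | ⟨a, j'⟩, hp, hq⟩ := List.mem_map.1 hj
    · cases hq
    · by_cases ha : A a
      · rw [Place.cut_inr_pos hA ha] at hq
        cases hq
      · rw [Place.cut_inr_neg hA ha] at hq
        cases hq
        exact hp⟩

/-- Functoriality of cutting for embeddings. -/
noncomputable def Hom.cutMap {d d' : Diagram S u v} (e : Hom d d') (b₀ : S.Box) {A : d.Box → Prop}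
    {A' : d'.Box → Prop} (hA : ∀ b, A b → d.label b = b₀) (hA' : ∀ b, A' b → d'.label b = b₀)
    (h : ∀ b, A' (e.box b) ↔ A b) : Hom (d.cut b₀ A hA) (d'.cut b₀ A' hA') where
  box b := ⟨e.box b.1, fun hb => b.2 ((h _).1 hb)⟩
  injective a b hab := Subtype.ext (e.injective (congrArg Subtype.val hab))
  label_eq b := e.label_eq b.1
  src_eq b := by
    change (d'.src (e.box b.1)).map (Place.cut hA') = ((d.src b.1).map (Place.cut hA)).map _
    rw [e.src_eq]
    refine map_sq fun p => ?_
    obtain i | ⟨b, j⟩ := p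
    · rfl
    · by_cases hb : A b
      · rw [Place.cut_inr_pos hA hb]
        exact Place.cut_inr_pos hA' ((h b).2 hb) _
      · rw [Place.cut_inr_neg hA hb]
        exact Place.cut_inr_neg hA' (fun k => hb ((h b).1 k)) _
  out_eq := by
    change d'.out.map (Place.cut hA') = (d.out.map (Place.cut hA)).map _
    rw [e.out_eq]
    refine map_sq fun p => ?_
    obtain i | ⟨b, j⟩ := p
    · rfl
    · by_cases hb : A b
      · rw [Place.cut_inr_pos hA hb]
        exact Place.cut_inr_pos hA' ((h b).2 hb) _
      · rw [Place.cut_inr_neg hA hb]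
        exact Place.cut_inr_neg hA' (fun k => hb ((h b).1 k)) _

open FreeMarkov (Compat rewireDiagram rewireDiagram_getElem)

lemma compRight_rewireDiagram {f : ℕ → ℕ} (h : Compat u v f) (d : Diagram S v x)
    (i : Fin v.length) :
    compRight (rewireDiagram u v f h) d (.inl i) = .inl ⟨f i, h.lt i.2⟩ :=
  congrArg (compLeft _ _) (rewireDiagram_getElem h i _)

lemma compRight_tensor_left {z : List S.Wire} (d : Diagram S u v) (d' : Diagram S x y)
    (e : Diagram S (v ++ y) z) (i : Fin (v ++ y).length) (hi : i.val < d.out.length) :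
    compRight (d.tensor d') e (.inl i) = compLeft _ _ (tensorLeft d d' d.out[i.val]) :=
  congrArg (compLeft _ _) (tensor_out_getElem_left d d' i _ hi)

lemma compRight_tensor_right {z : List S.Wire} (d : Diagram S u v) (d' : Diagram S x y)
    (e : Diagram S (v ++ y) z) (i : Fin (v ++ y).length) (k : ℕ) (hk : k < d'.out.length)
    (hi : i.val = v.length + k) :
    compRight (d.tensor d') e (.inl i) = compLeft _ _ (tensorRight d d' d'.out[k]) := by
  obtain rfl : k = i.val - v.length := by omega
  exact congrArg (compLeft _ _) (tensor_out_getElem_right d d' i _ (by omega) hk)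

lemma id_out_getElem (u : List S.Wire) (i : ℕ) (hi : i < (id u).out.length)
    (hi' : i < u.length) : (id u).out[i] = .inl ⟨i, hi'⟩ := by
  simp [id, wiring]

lemma single_out_getElem (b : S.Box) (i : ℕ) (hi : i < (single b).out.length)
    (hi' : i < (S.cod b).length) : (single b).out[i] = .inr ⟨(), ⟨i, hi'⟩⟩ := by
  simp [single]

lemma cut_out_getElem (d : Diagram S u v) {b₀ : S.Box} {A : d.Box → Prop}
    (hA : ∀ b, A b → d.label b = b₀) (i : ℕ) (hi : i < (d.cut b₀ A hA).out.length)
    (hi' : i < d.out.length) : (d.cut b₀ A hA).out[i] = d.out[i].cut hA :=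
  List.getElem_map _

/-! The following identities between iterated maps of lists leave the maps to be read off from the
goal, where they appear only after unfolding composites of diagrams. -/

lemma map_eq₂ {α β γ : Type*} {l : List α} {f : α → γ} {f₁ : α → β} {f₂ : β → γ}
    (h : ∀ p, f p = f₂ (f₁ p)) : l.map f = (l.map f₁).map f₂ := by
  simp [List.map_map, Function.comp_def, h]

lemma map_eq₄ {α β γ β₁ β₂ β₃ : Type*} {l : List α} {f : α → β} {g : β → γ} {f₁ : α → β₁}
    {f₂ : β₁ → β₂} {f₃ : β₂ → β₃} {f₄ : β₃ → γ} (h : ∀ p, g (f p) = f₄ (f₃ (f₂ (f₁ p)))) :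
    (l.map f).map g = (((l.map f₁).map f₂).map f₃).map f₄ := by
  simp [List.map_map, Function.comp_def, h]

lemma map_eq₅ {α β γ β₁ β₂ β₃ β₄ : Type*} {l : List α} {f : α → β} {g : β → γ} {f₁ : α → β₁}
    {f₂ : β₁ → β₂} {f₃ : β₂ → β₃} {f₄ : β₃ → β₄} {f₅ : β₄ → γ}
    (h : ∀ p, g (f p) = f₅ (f₄ (f₃ (f₂ (f₁ p))))) :
    (l.map f).map g = ((((l.map f₁).map f₂).map f₃).map f₄).map f₅ := by
  simp [List.map_map, Function.comp_def, h]

section comp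

variable (d : Diagram S u v) (d' : Diagram S v x) {b₀ : S.Box} {A : d.Box → Prop}
  {A' : d'.Box → Prop} (hA : ∀ b, A b → d.label b = b₀) (hA' : ∀ b, A' b → d'.label b = b₀)

lemma _root_.JointCausal.FreeMarkov.Compat.dup (K u : List S.Wire) :
    Compat (K ++ u) (K ++ (K ++ u)) (fun i => if i < K.length then i else i - K.length) := by
  intro i hi
  simp only [List.length_append] at hi
  dsimp only
  split_ifs with hv
  · rw [List.getElem?_append_left hv, List.getElem?_append_left hv]
  · rw [List.getElem?_append_right (l₂ := K ++ u) (by omega)]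

/-- The composite of the diagrams obtained by cutting two diagrams, where the additional inputs are
copied and supplied to both of them. -/
noncomputable def cutComp : Diagram S (S.cod b₀ ++ u) x :=
  (rewireDiagram _ _ _ (.dup (S.cod b₀) u)).comp
    (((id (S.cod b₀)).tensor (d.cut b₀ A hA)).comp (d'.cut b₀ A' hA'))

lemma sum_elim_label (hA : ∀ b, A b → d.label b = b₀) (hA' : ∀ b, A' b → d'.label b = b₀) :
    ∀ b : (d.comp d').Box, Sum.elim A A' b → (d.comp d').label b = b₀ := by
  rintro (b | b) h
  exacts [hA b h, hA' b h]

/-- The boxes of `cutComp` are those of the composite that are not cut. -/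
noncomputable def cutCompBox : (cutComp d d' hA hA').Box →
    ((d.comp d').cut b₀ (Sum.elim A A') (sum_elim_label d d' hA hA')).Box
  | .inl b => b.elim
  | .inr (.inl (.inl b)) => b.elim
  | .inr (.inl (.inr b)) => ⟨.inl b.1, b.2⟩
  | .inr (.inr b) => ⟨.inr b.1, b.2⟩

lemma cutCompBox_label (b : (cutComp d d' hA hA').Box) :
    ((d.comp d').cut b₀ (Sum.elim A A') (sum_elim_label d d' hA hA')).label
      (cutCompBox d d' hA hA' b) = (cutComp d d' hA hA').label b := by
  obtain b | (b | b) | b := b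
  exacts [b.elim, b.elim, rfl, rfl]

/-- The wires of `cutComp` as wires of the composite with boxes cut. -/
noncomputable def cutCompPlace : Place (S.cod b₀ ++ u) (cutComp d d' hA hA').label →
    Place (S.cod b₀ ++ u)
      ((d.comp d').cut b₀ (Sum.elim A A') (sum_elim_label d d' hA hA')).label :=
  Place.map (cutCompBox d d' hA hA') (cutCompBox_label d d' hA hA')

/-- A wire of `d` names the same wire of the cut composite, whether it is cut before or after
composing. -/
lemma cutComp_left (p : Place u d.label) :
    Place.cut (sum_elim_label d d' hA hA') (compLeft d d' p) = cutCompPlace d d' hA hA'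
      (compRight _ _ (compLeft _ _ (tensorRight _ _ (p.cut hA)))) := by
  obtain i | ⟨b, j⟩ := p
  · refine (Eq.trans (congrArg (cutCompPlace d d' hA hA') (compRight_rewireDiagram _ _ _)) ?_).symm
    refine congrArg Sum.inl (Fin.ext ?_)
    simp
  · by_cases hb : A b
    · rw [Place.cut_inr_pos hA hb]
      refine (Place.cut_inr_pos (sum_elim_label d d' hA hA') (b := Sum.inl b) hb j).trans ?_
      refine (Eq.trans (congrArg (cutCompPlace d d' hA hA') (compRight_rewireDiagram _ _ _))
        ?_).symm
      refine congrArg Sum.inl (Fin.ext ?_)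
      simp
    · rw [Place.cut_inr_neg hA hb]
      exact Place.cut_inr_neg (sum_elim_label d d' hA hA') (b := Sum.inl b) hb j

/-- An output of a box of `d'`, or an input of `d'`, which is traced back to an output of `d` and
thus to a wire of `d` as in `cutComp_left`. -/
lemma cutComp_right (p : Place v d'.label) :
    Place.cut (sum_elim_label d d' hA hA') (compRight d d' p) = cutCompPlace d d' hA hA'
      (compRight _ _ (compRight _ _ (p.cut hA'))) := by
  obtain i | ⟨b, j⟩ := p
  · refine (cutComp_left d d' hA hA' (d.out.get (i.cast d.out_length))).trans ?_
    have h1 : i.val < (d.cut b₀ A hA).out.length := by rw [← out_length]; exact i.2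
    have h2 := compRight_tensor_right (id (S.cod b₀)) (d.cut b₀ A hA) (d'.cut b₀ A' hA')
      ⟨(S.cod b₀).length + i, by simp⟩ i h1 rfl
    have h3 := cut_out_getElem d hA i h1 (by rw [← out_length]; exact i.2)
    rw [h3] at h2
    exact congrArg (fun q => cutCompPlace d d' hA hA' (compRight _ _ q)) h2.symm
  · by_cases hb : A' b
    · rw [Place.cut_inr_pos hA' hb]
      refine (Place.cut_inr_pos (sum_elim_label d d' hA hA') (b := Sum.inr b) hb j).trans ?_
      have hj : j.val < (S.cod b₀).length := by rw [← hA' b hb]; exact j.2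
      have h2 := compRight_tensor_left (id (S.cod b₀)) (d.cut b₀ A hA) (d'.cut b₀ A' hA')
        ⟨j, by simp; omega⟩ (by rw [← out_length]; exact hj)
      rw [id_out_getElem _ _ _ hj] at h2
      refine Eq.trans ?_ (congrArg (fun q => cutCompPlace d d' hA hA' (compRight _ _ q)) h2.symm)
      refine (Eq.trans (congrArg (cutCompPlace d d' hA hA') (compRight_rewireDiagram _ _ _))
        ?_).symm
      refine congrArg Sum.inl (Fin.ext ?_)
      exact if_pos hj
    · rw [Place.cut_inr_neg hA' hb]
      exact Place.cut_inr_neg (sum_elim_label d d' hA hA') (b := Sum.inr b) hb j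

/-- Cutting a composite amounts to cutting both diagrams and sharing the additional inputs. The
embedding is bijective on boxes. -/
noncomputable def cutCompHom : Hom (cutComp d d' hA hA')
    ((d.comp d').cut b₀ (Sum.elim A A') (sum_elim_label d d' hA hA')) where
  box := cutCompBox d d' hA hA'
  injective := by
    rintro (b | (b | b) | b)
    · exact b.elim
    · exact b.elim
    · rintro (b' | (b' | b') | b') h
      exacts [b'.elim, b'.elim, congrArg (fun b => Sum.inr (Sum.inl (Sum.inr b)))
        (Subtype.ext (Sum.inl_injective (congrArg Subtype.val h))),
        absurd (congrArg Subtype.val h) Sum.inl_ne_inr]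
    · rintro (b' | (b' | b') | b') h
      exacts [b'.elim, b'.elim, absurd (congrArg Subtype.val h) Sum.inr_ne_inl,
        congrArg (fun b => Sum.inr (Sum.inr b))
          (Subtype.ext (Sum.inr_injective (congrArg Subtype.val h)))]
  label_eq := cutCompBox_label d d' hA hA'
  src_eq := by
    rintro (b | (b | b) | b)
    · exact b.elim
    · exact b.elim
    · change ((d.src b.1).map _).map _ = (((((d.src b.1).map _).map _).map _).map _).map _
      exact map_eq₅ fun p => cutComp_left d d' hA hA' p
    · change ((d'.src b.1).map _).map _ = ((((d'.src b.1).map _).map _).map _).map _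
      exact map_eq₄ fun p => cutComp_right d d' hA hA' p
  out_eq := by
    change (d'.out.map _).map _ = (((d'.out.map _).map _).map _).map _
    exact map_eq₄ fun p => cutComp_right d d' hA hA' p

end comp

end Diagram
end JointCausal

/-! ### Cutting and the operations on diagrams -/

namespace JointCausal

open CategoryTheory MonoidalCategory

universe u v w

variable {S : Hypergraph.{w}} {u v x y : List S.Wire}

namespace FreeMarkov

lemma Compat.share (K u x : List S.Wire) :
    Compat (K ++ (u ++ x)) ((K ++ u) ++ (K ++ x)) (fun i => if i < (K ++ u).length then i else
      if i < (K ++ u).length + K.length then i - (K ++ u).length else i - K.length) := by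
  intro i hi
  rw [← List.append_assoc K u x]
  simp only [List.length_append] at hi ⊢
  split_ifs with h1 h2
  · rw [List.getElem?_append_left (l₁ := K ++ u) (by simpa using h1),
      List.getElem?_append_left (l₁ := K ++ u) (by simpa using h1)]
  · rw [List.append_assoc, List.getElem?_append_left (by omega),
      List.getElem?_append_right (by simp; omega), List.length_append,
      List.getElem?_append_left (by omega)]
  · rw [List.getElem?_append_right (by simp; omega),
      List.getElem?_append_right (l₁ := K ++ u) (by simp; omega), List.length_append,
      List.getElem?_append_right (l₁ := K) (by omega)]
    congr 1
    omega

lemma Compat.snd (K u : List S.Wire) : Compat (K ++ u) u (fun i => K.length + i) := by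
  intro i hi
  rw [List.getElem?_append_right (Nat.le_add_right _ _), Nat.add_sub_cancel_left]

lemma Compat.fst (K u : List S.Wire) : Compat (K ++ u) K (fun i => i) := by
  intro i hi
  rw [List.getElem?_append_left hi]

end FreeMarkov

namespace Diagram

open FreeMarkov (Compat rewireDiagram rewireDiagram_getElem rewire ofDiagram)

section tensor

variable (d : Diagram S u v) (d' : Diagram S x y) {b₀ : S.Box} {A : d.Box → Prop}
  {A' : d'.Box → Prop} (hA : ∀ b, A b → d.label b = b₀) (hA' : ∀ b, A' b → d'.label b = b₀)

/-- The juxtaposition of the diagrams obtained by cutting two diagrams, where the additional inputs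
are copied and supplied to both of them. -/
noncomputable def cutTensor : Diagram S (S.cod b₀ ++ (u ++ x)) (v ++ y) :=
  (rewireDiagram _ _ _ (.share (S.cod b₀) u x)).comp ((d.cut b₀ A hA).tensor (d'.cut b₀ A' hA'))

lemma sum_elim_label_tensor (hA : ∀ b, A b → d.label b = b₀) (hA' : ∀ b, A' b → d'.label b = b₀) :
    ∀ b : (d.tensor d').Box, Sum.elim A A' b → (d.tensor d').label b = b₀ := by
  rintro (b | b) h
  exacts [hA b h, hA' b h]

/-- The boxes of `cutTensor` are those of the juxtaposition that are not cut. -/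
noncomputable def cutTensorBox : (cutTensor d d' hA hA').Box →
    ((d.tensor d').cut b₀ (Sum.elim A A') (sum_elim_label_tensor d d' hA hA')).Box
  | .inl b => b.elim
  | .inr (.inl b) => ⟨.inl b.1, b.2⟩
  | .inr (.inr b) => ⟨.inr b.1, b.2⟩

lemma cutTensorBox_label (b : (cutTensor d d' hA hA').Box) :
    ((d.tensor d').cut b₀ (Sum.elim A A') (sum_elim_label_tensor d d' hA hA')).label
      (cutTensorBox d d' hA hA' b) = (cutTensor d d' hA hA').label b := by
  obtain b | b | b := b
  exacts [b.elim, rfl, rfl]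

/-- The wires of `cutTensor` as wires of the juxtaposition with boxes cut. -/
noncomputable def cutTensorPlace : Place (S.cod b₀ ++ (u ++ x)) (cutTensor d d' hA hA').label →
    Place (S.cod b₀ ++ (u ++ x))
      ((d.tensor d').cut b₀ (Sum.elim A A') (sum_elim_label_tensor d d' hA hA')).label :=
  Place.map (cutTensorBox d d' hA hA') (cutTensorBox_label d d' hA hA')

lemma cutTensor_left (p : Place u d.label) :
    Place.cut (sum_elim_label_tensor d d' hA hA') (tensorLeft d d' p) = cutTensorPlace d d' hA hA'
      (compRight _ _ (tensorLeft _ _ (p.cut hA))) := by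
  obtain i | ⟨b, j⟩ := p
  · refine (Eq.trans (congrArg (cutTensorPlace d d' hA hA') (compRight_rewireDiagram _ _ _))
      ?_).symm
    refine congrArg Sum.inl (Fin.ext ?_)
    exact if_pos (by simp)
  · by_cases hb : A b
    · rw [Place.cut_inr_pos hA hb]
      refine (Place.cut_inr_pos (sum_elim_label_tensor d d' hA hA') (b := Sum.inl b) hb j).trans ?_
      refine (Eq.trans (congrArg (cutTensorPlace d d' hA hA') (compRight_rewireDiagram _ _ _))
        ?_).symm
      refine congrArg Sum.inl (Fin.ext ?_)
      have hj : j.val < (S.cod b₀).length := by rw [← hA b hb]; exact j.2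
      exact if_pos (by simp; omega)
    · rw [Place.cut_inr_neg hA hb]
      exact Place.cut_inr_neg (sum_elim_label_tensor d d' hA hA') (b := Sum.inl b) hb j

lemma cutTensor_right (p : Place x d'.label) :
    Place.cut (sum_elim_label_tensor d d' hA hA') (tensorRight d d' p) = cutTensorPlace d d' hA hA'
      (compRight _ _ (tensorRight _ _ (p.cut hA'))) := by
  obtain i | ⟨b, j⟩ := p
  · refine (Eq.trans (congrArg (cutTensorPlace d d' hA hA') (compRight_rewireDiagram _ _ _))
      ?_).symm
    refine congrArg Sum.inl (Fin.ext ?_)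
    simp only [List.length_append]
    split_ifs <;> omega
  · by_cases hb : A' b
    · rw [Place.cut_inr_pos hA' hb]
      refine (Place.cut_inr_pos (sum_elim_label_tensor d d' hA hA') (b := Sum.inr b) hb j).trans ?_
      refine (Eq.trans (congrArg (cutTensorPlace d d' hA hA') (compRight_rewireDiagram _ _ _))
        ?_).symm
      refine congrArg Sum.inl (Fin.ext ?_)
      have hj : j.val < (S.cod b₀).length := by rw [← hA' b hb]; exact j.2
      simp only [List.length_append]
      split_ifs <;> omega
    · rw [Place.cut_inr_neg hA' hb]
      exact Place.cut_inr_neg (sum_elim_label_tensor d d' hA hA') (b := Sum.inr b) hb j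

/-- Cutting a juxtaposition amounts to cutting both diagrams and sharing the additional inputs. -/
noncomputable def cutTensorHom : Hom (cutTensor d d' hA hA')
    ((d.tensor d').cut b₀ (Sum.elim A A') (sum_elim_label_tensor d d' hA hA')) where
  box := cutTensorBox d d' hA hA'
  injective := by
    rintro (b | b | b)
    · exact b.elim
    · rintro (b' | b' | b') h
      exacts [b'.elim, congrArg (fun b => Sum.inr (Sum.inl b))
        (Subtype.ext (Sum.inl_injective (congrArg Subtype.val h))),
        absurd (congrArg Subtype.val h) Sum.inl_ne_inr]
    · rintro (b' | b' | b') h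
      exacts [b'.elim, absurd (congrArg Subtype.val h) Sum.inr_ne_inl,
        congrArg (fun b => Sum.inr (Sum.inr b))
          (Subtype.ext (Sum.inr_injective (congrArg Subtype.val h)))]
  label_eq := cutTensorBox_label d d' hA hA'
  src_eq := by
    rintro (b | b | b)
    · exact b.elim
    · change ((d.src b.1).map _).map _ = ((((d.src b.1).map _).map _).map _).map _
      exact map_eq₄ fun p => cutTensor_left d d' hA hA' p
    · change ((d'.src b.1).map _).map _ = ((((d'.src b.1).map _).map _).map _).map _
      exact map_eq₄ fun p => cutTensor_right d d' hA hA' p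
  out_eq := by
    have key {α β γ δ ε : Type} (l : List α) (l' : List β) (f : α → γ) (f' : β → γ) (g : γ → δ)
        (g' : δ → ε) : (((l.map f) ++ (l'.map f')).map g).map g' =
        ((l.map f).map g).map g' ++ ((l'.map f').map g).map g' := by simp
    refine Eq.trans ?_ (key ((d.cut b₀ A hA).out) ((d'.cut b₀ A' hA').out) _ _ _ _).symm
    refine List.map_append.trans ?_
    refine congrArg₂ _ ?_ ?_
    · change (d.out.map _).map _ = (((d.out.map _).map _).map _).map _
      exact map_eq₄ fun p => cutTensor_left d d' hA hA' p
    · change (d'.out.map _).map _ = (((d'.out.map _).map _).map _).map _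
      exact map_eq₄ fun p => cutTensor_right d d' hA hA' p

end tensor

/-- Cutting no boxes only adds unused inputs. -/
noncomputable def cutNoneHom (d : Diagram S u v) {b₀ : S.Box} {A : d.Box → Prop}
    (hA : ∀ b, A b → d.label b = b₀) (h : ∀ b, ¬ A b) :
    Hom ((rewireDiagram _ _ _ (.snd (S.cod b₀) u)).comp d) (d.cut b₀ A hA) :=
  let e : ((rewireDiagram _ _ _ (.snd (S.cod b₀) u)).comp d).Box → (d.cut b₀ A hA).Box :=
    Sum.elim Empty.elim fun b => ⟨b, h b⟩
  have he : ∀ b, (d.cut b₀ A hA).label (e b) =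
      ((rewireDiagram _ _ _ (.snd (S.cod b₀) u)).comp d).label b := by
    rintro (b | b)
    exacts [b.elim, rfl]
  have key : ∀ p : Place u d.label, p.cut hA = Place.map (label' := (d.cut b₀ A hA).label) e he
      (compRight (rewireDiagram _ _ _ (.snd (S.cod b₀) u)) d p) := by
    rintro (i | ⟨b, j⟩)
    · exact (congrArg (Place.map (label' := (d.cut b₀ A hA).label) e he)
        (compRight_rewireDiagram _ _ _)).symm
    · exact Place.cut_inr_neg hA (h b) j
  { box := e
    injective := by
      rintro (b | b)
      · exact b.elim
      · rintro (b' | b') hb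
        exacts [b'.elim, congrArg Sum.inr (congrArg Subtype.val hb)]
    label_eq := he
    src_eq := by
      rintro (b | b)
      · exact b.elim
      · exact map_eq₂ key
    out_eq := map_eq₂ key }

lemma ofDiagram_cut_single (b₀ : S.Box) (A : (single b₀).Box → Prop) (hA) (h : ∀ b, A b) :
    ofDiagram ((single b₀).cut b₀ A hA) =
      rewire (S.cod b₀ ++ S.dom b₀) (S.cod b₀) (fun i => i) (.fst _ _) := by
  refine FreeMarkov.ofDiagram_eq_rewire _ _ ⟨fun b => b.2 (h b.1)⟩ fun i hi hi' => ?_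
  refine (cut_out_getElem _ hA i hi (by rwa [← out_length])).trans ?_
  refine (congrArg (Place.cut hA) (single_out_getElem b₀ i _ hi')).trans ?_
  exact Place.cut_inr_pos hA (h ()) _

end Diagram

namespace FreeMarkov

lemma dup_eq_rewire (K u : List S.Wire) :
    dup (of K) (of u) = rewire (K ++ u) (K ++ (K ++ u)) _ (.dup K u) := by
  refine (congrArg₂ _ ((congrArg₂ tensorHom (copy_eq_rewire K) (id_eq_rewire u)).trans
    (rewire_tensor (u := K) (v := K ++ K) (x := u) (y := u) _ _))
    (eqToHom_eq_rewire (u := (K ++ K) ++ u) (v := K ++ (K ++ u)) _)).trans ?_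
  refine (rewire_comp _ _).trans ?_
  refine rewire_congr _ _ fun i hi => ?_
  simp only [List.length_append] at hi ⊢
  split_ifs <;> omega

lemma share_eq_rewire (K u x : List S.Wire) : share (of K) (of u) (of x) =
    rewire (K ++ (u ++ x)) ((K ++ u) ++ (K ++ x)) _ (.share K u x) := by
  have h := eqToHom_eq_rewire (u := K ++ (u ++ x)) (v := (K ++ u) ++ x)
    (congrArg of (List.append_assoc _ _ _).symm)
  have h' := eqToHom_eq_rewire (u := K ++ (x ++ (K ++ u))) (v := (K ++ x) ++ (K ++ u))
    (congrArg of (List.append_assoc _ _ _).symm)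
  have e1 := (congrArg₂ (· ≫ ·) h (swap_eq_rewire (K ++ u) x)).trans (rewire_comp _ _)
  have e2 := (congrArg₂ tensorHom (id_eq_rewire K) e1).trans
    (rewire_tensor (u := K) (v := K) (x := K ++ (u ++ x)) (y := x ++ (K ++ u)) _ _)
  have e3 := (congrArg₂ (· ≫ ·) h' (swap_eq_rewire (K ++ x) (K ++ u))).trans (rewire_comp _ _)
  have e4 := (congrArg₂ (· ≫ ·) e2 e3).trans (rewire_comp _ _)
  have e5 := (congrArg₂ (· ≫ ·) (dup_eq_rewire K (u ++ x)) e4).trans (rewire_comp _ _)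
  refine Eq.trans e5 (rewire_congr _ _ fun i hi => ?_)
  simp only [List.length_append] at hi ⊢
  split_ifs <;> omega

end FreeMarkov

end JointCausal

/-! ### Replacing boxes by constants -/

namespace JointCausal

open CategoryTheory MonoidalCategory

universe u v w

variable {S : Hypergraph.{w}} {M : Type u} [Category.{v} M] [MonoidalCategory M] [MarkovCategory M]

namespace FreeMarkov

variable {u v x y : List S.Wire}

/-- The morphism obtained by cutting all boxes labelled `b₀` out of a diagram. -/
noncomputable def cut (b₀ : S.Box) (d : Diagram S u v) : (of (S.cod b₀)).tensorObj (of u) ⟶ of v :=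
  ofDiagram (d.cut b₀ (fun b => d.label b = b₀) fun _ h => h)

lemma cut_eq {d d' : Diagram S u v} (b₀ : S.Box) (e : d.Hom d') : cut b₀ d = cut b₀ d' :=
  ofDiagram_eq (e.cutMap b₀ _ _ fun b => by rw [e.label_eq])

lemma ofDiagram_cut_congr (d : Diagram S u v) {b₀ : S.Box} {A : d.Box → Prop}
    (hA : ∀ b, A b → d.label b = b₀) (h : ∀ b, A b ↔ d.label b = b₀) :
    ofDiagram (d.cut b₀ A hA) = cut b₀ d := by
  obtain rfl : A = fun b => d.label b = b₀ := funext fun b => propext (h b)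
  rfl

lemma cut_comp (b₀ : S.Box) (d : Diagram S u v) (d' : Diagram S v x) :
    cut b₀ (d.comp d') = dup (of (S.cod b₀)) (of u) ≫
      tensorHom (𝟙 (of (S.cod b₀))) (cut b₀ d) ≫ cut b₀ d' := by
  rw [← ofDiagram_cut_congr (d.comp d') (Diagram.sum_elim_label d d' (b₀ := b₀) (fun _ h => h)
    fun _ h => h) (by rintro (b | b) <;> rfl), ← ofDiagram_eq (Diagram.cutCompHom d d' _ _),
    Diagram.cutComp, ofDiagram_comp, ofDiagram_comp, ofDiagram_tensor, ← id_eq_ofDiagram,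
    dup_eq_rewire]
  rfl

lemma cut_tensor (b₀ : S.Box) (d : Diagram S u v) (d' : Diagram S x y) :
    cut b₀ (d.tensor d') = share (of (S.cod b₀)) (of u) (of x) ≫
      tensorHom (cut b₀ d) (cut b₀ d') := by
  rw [← ofDiagram_cut_congr (d.tensor d') (Diagram.sum_elim_label_tensor d d' (b₀ := b₀)
    (fun _ h => h) fun _ h => h) (by rintro (b | b) <;> rfl),
    ← ofDiagram_eq (Diagram.cutTensorHom d d' _ _), Diagram.cutTensor, ofDiagram_comp,
    ofDiagram_tensor, share_eq_rewire]
  rfl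

/-- Nothing is cut if no box is labelled `b₀`, and the additional inputs are ignored. -/
lemma cut_of_forall_ne (b₀ : S.Box) (d : Diagram S u v) (h : ∀ b, d.label b ≠ b₀) :
    cut b₀ d = snd (of (S.cod b₀)) (of u) ≫ ofDiagram d := by
  rw [cut, ← ofDiagram_eq (Diagram.cutNoneHom d _ h), ofDiagram_comp]
  refine congrArg (· ≫ ofDiagram d) ?_
  refine Eq.trans ?_ ((congrArg₂ tensorHom (del_eq_rewire (S.cod b₀) id) (id_eq_rewire u)).trans
    (rewire_tensor (u := S.cod b₀) (v := []) (x := u) (y := u) _ _)).symm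
  exact rewire_congr _ _ fun i hi => rfl

/-- Cutting a single box leaves the additional inputs as outputs. -/
lemma cut_single (b₀ : S.Box) : cut b₀ (.single b₀) =
    fst (of (S.cod b₀)) (of (S.dom b₀)) := by
  refine (Diagram.ofDiagram_cut_single b₀ _ _ fun _ => rfl).trans ?_
  have h := (congrArg₂ tensorHom (id_eq_rewire (S.cod b₀)) (del_eq_rewire (S.dom b₀) id)).trans
    (rewire_tensor (u := S.cod b₀) (v := S.cod b₀) (x := S.dom b₀) (y := []) _ _)
  refine Eq.trans ?_ ((congrArg₂ (· ≫ ·) h (swap_eq_rewire (S.cod b₀) [])).trans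
    (rewire_comp _ _)).symm
  exact rewire_congr _ _ fun i hi => by simp [hi]

end FreeMarkov

namespace IsStrictMarkov

variable {F : FreeMarkov S ⥤ Joint M} (hF : IsStrictMarkov F) [IsStrictMonoidal M] {b₀ : S.Box}
  (X : F.obj .unit ⟶ F.obj (.of (S.cod b₀)))

/-- The value of a diagram when all boxes labelled `b₀` return the point `X`: supply `X` to the
diagram from which these boxes are cut. -/
noncomputable def doDiagram {u v : List S.Wire} (d : Diagram S u v) :
    F.obj (.of u) ⟶ F.obj (.of v) :=
  hF.pad X (.of u) ≫ F.map (FreeMarkov.cut b₀ d)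

/-- The value of a morphism when all boxes labelled `b₀` return the point `X`. -/
noncomputable def doMap {u v : FreeMarkov S} : (u ⟶ v) → (F.obj u ⟶ F.obj v) :=
  Quotient.lift (fun d => hF.doDiagram X d.1) fun _ _ ⟨e, _⟩ =>
    congrArg (fun f => hF.pad X u ≫ F.map f) (FreeMarkov.cut_eq b₀ e)

lemma doMap_ofDiagram {u v : List S.Wire} (d : Diagram S u v) :
    hF.doMap X (FreeMarkov.ofDiagram d) = hF.doDiagram X d :=
  congrArg (fun f => hF.pad X (.of u) ≫ F.map f) (FreeMarkov.cut_eq b₀ d.normIncl)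

lemma doDiagram_of_forall_ne {u v : List S.Wire} (d : Diagram S u v) (h : ∀ b, d.label b ≠ b₀) :
    hF.doDiagram X d = F.map (FreeMarkov.ofDiagram d) := by
  rw [doDiagram, FreeMarkov.cut_of_forall_ne b₀ d h, F.map_comp, reassoc_of% (hF.pad_snd X (.of u))]

lemma doMap_wiring {u v : FreeMarkov S} (l : List (Fin u.wires.length))
    (h : l.map u.wires.get = v.wires) :
    hF.doMap X (FreeMarkov.wiring l h) = F.map (FreeMarkov.wiring l h) := by
  obtain ⟨u⟩ := u
  obtain ⟨v⟩ := v
  rw [FreeMarkov.wiring_eq_ofDiagram, doMap_ofDiagram, doDiagram_of_forall_ne]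
  exact fun b => b.elim

variable {X} (hX : X ≫ F.map (FreeMarkov.copy _) = hF.tens X X)

lemma doDiagram_tensor (hX : X ≫ F.map (FreeMarkov.copy _) = hF.tens X X)
    {u v x y : List S.Wire} (d : Diagram S u v) (d' : Diagram S x y) :
    hF.doDiagram X (d.tensor d') = hF.tens (hF.doDiagram X d) (hF.doDiagram X d') := by
  have h : hF.pad X ((FreeMarkov.of u).tensorObj (.of x)) ≫
      F.map (FreeMarkov.share (.of (S.cod b₀)) (.of u) (.of x) ≫
        FreeMarkov.tensorHom (FreeMarkov.cut b₀ d) (FreeMarkov.cut b₀ d')) =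
      hF.tens (hF.doDiagram X d) (hF.doDiagram X d') := by
    rw [doDiagram, doDiagram, F.map_comp, hF.map_tens, hF.tens_comp, hF.pad_tens_pad X hX,
      Category.assoc]
  refine Eq.trans ?_ h
  exact congrArg (fun f : (FreeMarkov.of (S.cod b₀)).tensorObj
    ((FreeMarkov.of u).tensorObj (.of x)) ⟶ (FreeMarkov.of v).tensorObj (.of y) =>
      hF.pad X _ ≫ F.map f) (FreeMarkov.cut_tensor b₀ d d')

/-- The strict Markov functor that differs from `F` only in that the box `b₀` returns the copyable
point `X`. -/
noncomputable def doBox : FreeMarkov S ⥤ Joint M where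
  obj := F.obj
  map := hF.doMap X
  map_id u := (hF.doMap_wiring X _ _).trans (F.map_id u)
  map_comp {u v x} f g := by
    obtain ⟨d, rfl⟩ := FreeMarkov.exists_ofDiagram f
    obtain ⟨d', rfl⟩ := FreeMarkov.exists_ofDiagram g
    rw [← FreeMarkov.ofDiagram_comp, doMap_ofDiagram, doMap_ofDiagram, doMap_ofDiagram, doDiagram,
      doDiagram, doDiagram, FreeMarkov.cut_comp, F.map_comp,
      ← reassoc_of% (hF.pad_pad X hX (.of u.wires)), F.map_comp, hF.map_tens, F.map_id,
      reassoc_of% (hF.pad_naturality X (F.map (FreeMarkov.cut b₀ d))), Category.assoc]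

lemma doBox_map {u v : FreeMarkov S} (f : u ⟶ v) : (hF.doBox hX).map f = hF.doMap X f := rfl

lemma doBox_strict : IsStrictMarkov (hF.doBox hX) where
  obj_unit := hF.obj_unit
  obj_tensor := hF.obj_tensor
  map_tensor {u v x y} f g := by
    obtain ⟨d, rfl⟩ := FreeMarkov.exists_ofDiagram f
    obtain ⟨d', rfl⟩ := FreeMarkov.exists_ofDiagram g
    have key : hF.doMap X
        (FreeMarkov.tensorHom (FreeMarkov.ofDiagram d) (FreeMarkov.ofDiagram d')) =
        hF.tens (hF.doMap X (FreeMarkov.ofDiagram d)) (hF.doMap X (FreeMarkov.ofDiagram d')) := by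
      refine (congrArg (hF.doMap X) (FreeMarkov.ofDiagram_tensor d d').symm).trans ?_
      refine (hF.doMap_ofDiagram X _).trans ?_
      rw [doMap_ofDiagram, doMap_ofDiagram]
      exact hF.doDiagram_tensor hX d d'
    exact key
  map_swap u v := (hF.doMap_wiring X _ _).trans (hF.map_swap u v)
  map_copy u := (hF.doMap_wiring X _ _).trans (hF.map_copy u)
  map_del u := (hF.doMap_wiring X _ _).trans (hF.map_del u)

lemma doBox_map_box_self :
    (hF.doBox hX).map (FreeMarkov.box b₀) = F.map (FreeMarkov.del _) ≫ X := by
  refine (hF.doBox_map hX _).trans ?_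
  rw [FreeMarkov.box_eq_ofDiagram, doMap_ofDiagram, doDiagram, FreeMarkov.cut_single]
  exact hF.pad_fst X (.of (S.dom b₀))

lemma doBox_map_box_of_ne {b : S.Box} (h : b ≠ b₀) :
    (hF.doBox hX).map (FreeMarkov.box b) = F.map (FreeMarkov.box b) := by
  refine (hF.doBox_map hX _).trans ?_
  rw [FreeMarkov.box_eq_ofDiagram, doMap_ofDiagram, doDiagram_of_forall_ne]
  exact fun _ => h

end IsStrictMarkov

lemma Joint.ofDet_comp_copy {Z X : Joint M} (k : Z.obj ⟶ X.obj) (hk : Deterministic k) :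
    (ofDet k hk : Z ⟶ X) ≫ copy X = copy Z ≫ tensorHom (ofDet k hk) (ofDet k hk) := by
  rw [tensorHom_ofDet]
  refine (ofDet_comp_ofDet _ _ _ _).trans (Eq.trans ?_ (ofDet_comp_ofDet _ _ _ _).symm)
  congr 1
  exact det_copy k hk

namespace IsStrictMarkov

variable {F : FreeMarkov S ⥤ Joint M} (hF : IsStrictMarkov F) [IsStrictMonoidal M]

/-- Deterministic points can be copied. -/
lemma comp_copy_of_det {K : FreeMarkov S} (x : Joint.unit.obj ⟶ (F.obj K).obj)
    (hx : Deterministic x) :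
    (eqToHom hF.obj_unit ≫ (Joint.ofDet x hx : Joint.unit ⟶ F.obj K)) ≫
        F.map (FreeMarkov.copy K) =
      hF.tens (eqToHom hF.obj_unit ≫ (Joint.ofDet x hx : Joint.unit ⟶ F.obj K))
        (eqToHom hF.obj_unit ≫ (Joint.ofDet x hx : Joint.unit ⟶ F.obj K)) := by
  rw [hF.map_copy, tens, Joint.tensorHom_comp, Category.assoc,
    reassoc_of% (Joint.ofDet_comp_copy x hx)]
  simp only [← Category.assoc]
  refine congrArg (fun f => (f ≫ _) ≫ _) ?_
  -- What remains is an identity between maps into `1 ⊗ 1`, which is the unit by strictness.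
  exact Joint.hom_ext_of_eq_unit (Joint.unit_tensorObj _) _ _

/-- A strict Markov functor can be changed into a constant on a single box. -/
lemma exists_do_box (hF : IsStrictMarkov F) (b₀ : S.Box)
    (x : 𝟙_ M ⟶ (F.obj (.of (S.cod b₀))).obj) (hx : Deterministic x) :
    ∃ G : FreeMarkov S ⥤ Joint M, ∃ hobj : ∀ u, G.obj u = F.obj u, IsStrictMarkov G ∧
      G.map (FreeMarkov.box b₀) =
        eqToHom (hobj _) ≫ Joint.const _ x hx ≫ eqToHom (hobj _).symm ∧
      ∀ b ≠ b₀, G.map (FreeMarkov.box b) =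
        eqToHom (hobj _) ≫ F.map (FreeMarkov.box b) ≫ eqToHom (hobj _).symm := by
  have hX := hF.comp_copy_of_det x hx
  have h₀ : (hF.doBox hX).map (FreeMarkov.box b₀) = 𝟙 _ ≫ Joint.const _ x hx ≫ 𝟙 _ := by
    rw [doBox_map_box_self, hF.map_del, Category.comp_id, Category.id_comp]
    simp only [Category.assoc, eqToHom_trans_assoc, eqToHom_refl, Category.id_comp]
    exact Joint.ofDet_comp_ofDet _ _ _ _
  have h (b) (hb : b ≠ b₀) :
      (hF.doBox hX).map (FreeMarkov.box b) = 𝟙 _ ≫ F.map (FreeMarkov.box b) ≫ 𝟙 _ := by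
    rw [Category.comp_id, Category.id_comp, hF.doBox_map_box_of_ne hX hb]
  exact ⟨hF.doBox hX, fun _ => rfl, hF.doBox_strict hX, h₀, h⟩

/-- An intervention can be performed on any finite set of boxes, one box after the other. -/
lemma exists_intervention_finset (hF : IsStrictMarkov F) (act : Intervention F)
    (s : Finset S.Box) [DecidableEq S.Box] :
    ∃ G : FreeMarkov S ⥤ Joint M, ∃ hobj : ∀ u, G.obj u = F.obj u, IsStrictMarkov G ∧
      ∀ b, G.map (FreeMarkov.box b) = eqToHom (hobj _) ≫
        (if b ∈ s then act.box b else F.map (FreeMarkov.box b)) ≫ eqToHom (hobj _).symm := by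
  induction s using Finset.induction_on with
  | empty => exact ⟨F, fun _ => rfl, hF, by simp⟩
  | insert b₀ s hb₀ ih =>
    obtain ⟨G, hobj, hG, h⟩ := ih
    obtain hact | ⟨x, hx⟩ := Option.eq_none_or_eq_some (act b₀)
    · refine ⟨G, hobj, hG, fun b => ?_⟩
      rw [h]
      by_cases hb : b = b₀
      · subst hb
        simp [hb₀, Intervention.box, hact]
      · simp [hb]
    · have hbox : act.box b₀ = Joint.const _ x.1 x.2 := by simp only [Intervention.box, hx]
      clear hx
      -- Make the functors agree on objects definitionally, so that the point `x` of `F` becomes a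
      -- point of `G`.
      obtain ⟨x, hx⟩ := x
      obtain ⟨obj, map, map_id, map_comp⟩ := G
      obtain rfl : obj = F.obj := funext hobj
      obtain ⟨G', hobj', hG', h₀, h'⟩ := hG.exists_do_box b₀ x hx
      refine ⟨G', hobj', hG', fun b => ?_⟩
      by_cases hb : b = b₀
      · subst hb
        rw [h₀, if_pos (Finset.mem_insert_self _ _), hbox]
      · rw [h' b hb, h b]
        simp [hb]

lemma exists_intervention [Finite S.Box] (hF : IsStrictMarkov F) (act : Intervention F) :
    ∃ G : FreeMarkov S ⥤ Joint M, ∃ hobj : ∀ u, G.obj u = F.obj u, IsStrictMarkov G ∧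
      ∀ b, G.map (FreeMarkov.box b) =
        eqToHom (hobj _) ≫ act.box b ≫ eqToHom (hobj _).symm := by
  classical
  have := Fintype.ofFinite S.Box
  obtain ⟨G, hobj, hG, h⟩ := hF.exists_intervention_finset act Finset.univ
  exact ⟨G, hobj, hG, fun b => by rw [h, if_pos (Finset.mem_univ b)]⟩

end IsStrictMarkov

end JointCausal

/-! ### Generation by boxes and the uniqueness of functors -/

namespace JointCausal

open CategoryTheory MonoidalCategory

universe u v w

variable {S : Hypergraph.{w}}

namespace FreeMarkov

/-- The morphisms generated by copy and delete maps and boxes under composition and tensor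
products. -/
inductive Generated : ∀ {u v : FreeMarkov S}, (u ⟶ v) → Prop
  | id (u : FreeMarkov S) : Generated (𝟙 u)
  | comp {u v x : FreeMarkov S} {f : u ⟶ v} {g : v ⟶ x} :
      Generated f → Generated g → Generated (f ≫ g)
  | tensor {u v x y : FreeMarkov S} {f : u ⟶ v} {g : x ⟶ y} :
      Generated f → Generated g → Generated (tensorHom f g)
  | copy (u : FreeMarkov S) : Generated (copy u)
  | del (u : FreeMarkov S) : Generated (del u)
  | box (b : S.Box) : Generated (box b)

/-- The projection to a single wire deletes the wires on both sides of it. -/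
lemma generated_rewire_singleton (a c : List S.Wire) (w : S.Wire) (f : ℕ → ℕ)
    (h : Compat (a ++ (w :: c)) [w] f) (hf : f 0 = a.length) :
    Generated (rewire (a ++ (w :: c)) [w] f h) := by
  have e1 := (congrArg₂ tensorHom (id_eq_rewire [w]) (del_eq_rewire c _root_.id)).trans
    (rewire_tensor (u := [w]) (v := [w]) (x := c) (y := []) _ _)
  have e2 := (congrArg₂ tensorHom (del_eq_rewire a _root_.id) e1).trans
    (rewire_tensor (u := a) (v := []) (x := [w] ++ c) (y := [w] ++ []) _ _)
  have e3 : tensorHom (del (of a)) (tensorHom (𝟙 (of [w])) (del (of c))) =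
      rewire (a ++ (w :: c)) [w] f h := by
    refine e2.trans (rewire_congr (u := a ++ (w :: c)) (v := [w]) _ _ fun i hi => ?_)
    obtain rfl : i = 0 := by simpa using hi
    simp [hf]
  rw [← e3]
  exact .tensor (.del _) (.tensor (.id _) (.del _))

/-- Rewirings are tuples of projections, so no swaps are needed to generate them. -/
lemma generated_rewire (u v : List S.Wire) (f : ℕ → ℕ) (h : Compat u v f) :
    Generated (rewire u v f h) := by
  induction v generalizing f with
  | nil =>
    rw [← del_eq_rewire]
    exact .del _
  | cons w v ih =>
    have hw : Compat u [w] f := fun i hi => by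
      obtain rfl : i = 0 := by simpa using hi
      exact h 0 (by simp)
    have hv : Compat u v (fun i => f (i + 1)) := fun i hi => by
      simpa using h (i + 1) (by simpa using hi)
    have e1 : FreeMarkov.copy (of u) ≫ tensorHom (rewire u [w] f hw) (rewire u v _ hv) =
        rewire u (w :: v) f h := by
      refine ((congrArg₂ (· ≫ ·) (copy_eq_rewire u) (rewire_tensor hw hv)).trans
        (rewire_comp _ _)).trans (rewire_congr (u := u) (v := w :: v) _ _ fun i hi => ?_)
      have h1 := hw.lt (i := 0) (by simp)
      obtain rfl | i := i
      · simp [h1]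
      · simp
    have hs : Generated (rewire u [w] f hw) := by
      have h0 := h 0 (by simp)
      have hlt := hw.lt (i := 0) (by simp)
      have hu : u = u.take (f 0) ++ (w :: u.drop (f 0 + 1)) := by
        have : w = u[f 0] := by
          rw [List.getElem?_eq_getElem hlt] at h0
          simpa using h0.symm
        rw [this, List.cons_getElem_drop_succ, List.take_append_drop]
      have key : ∀ (u' : List S.Wire) (_ : u = u') (h' : Compat u' [w] f),
          Generated (rewire u' [w] f h') → Generated (rewire u [w] f hw) := by
        rintro _ rfl _ h'
        exact h'
      exact key _ hu (hu ▸ hw) (generated_rewire_singleton _ _ _ _ _ (by simp; omega))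
    rw [← e1]
    exact .comp (.copy _) (.tensor hs (ih _ hv))

variable {u v x y : List S.Wire}

/-- By acyclicity, feeding is well-founded; a minimal box is fed only by inputs of the diagram. -/
lemma exists_box_not_fed (d : Diagram S u v) (h : Nonempty d.Box) :
    ∃ b, ∀ p ∈ d.src b, ∃ i, p = .inl i := by
  have := d.finite
  have wf : WellFounded (Relation.TransGen d.Feeds) :=
    have : Std.Irrefl (Relation.TransGen d.Feeds) := ⟨d.acyclic⟩
    Finite.wellFounded_of_trans_of_irrefl _
  obtain ⟨b, -, hb⟩ := wf.has_min Set.univ Set.univ_nonempty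
  refine ⟨b, fun p hp => ?_⟩
  obtain i | ⟨b', j⟩ := p
  · exact ⟨i, rfl⟩
  · exact absurd (.single ⟨j, hp⟩) (hb b' trivial)

end FreeMarkov

namespace Diagram

open FreeMarkov (Compat rewireDiagram)

variable {u v : List S.Wire}

lemma eq_map₄ {α β₁ β₂ β₃ : Type*} {l : List α} {f₁ : α → β₁} {f₂ : β₁ → β₂} {f₃ : β₂ → β₃}
    {f₄ : β₃ → α} (h : ∀ p, p = f₄ (f₃ (f₂ (f₁ p)))) :
    l = (((l.map f₁).map f₂).map f₃).map f₄ := by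
  simp [List.map_map, Function.comp_def, ← h]

lemma eq_map_finRange₅ {n : ℕ} {α β₁ β₂ β₃ β₄ : Type*} {l : List α} {f₁ : Fin n → β₁}
    {f₂ : β₁ → β₂} {f₃ : β₂ → β₃} {f₄ : β₃ → β₄} {f₅ : β₄ → α} (hl : l.length = n)
    (h : ∀ i (h1 : i < l.length) (h2 : i < n), l[i] = f₅ (f₄ (f₃ (f₂ (f₁ ⟨i, h2⟩))))) :
    l = (((((List.finRange n).map f₁).map f₂).map f₃).map f₄).map f₅ := by
  apply List.ext_getElem
  · simp [hl]
  · intro i h1 h2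
    simp [h i h1 (hl ▸ h1)]

/-- Positions are natural numbers as in `FreeMarkov.rewire`. -/
lemma exists_positions {B : Type} {label : B → S.Box} (l : List (Place u label))
    (hl : ∀ p ∈ l, ∃ i, p = .inl i) : ∃ f : ℕ → ℕ, ∀ i (hi : i < l.length), ∃ h : f i < u.length,
      l[i] = .inl ⟨f i, h⟩ := by
  choose f hf using fun i : Fin l.length => hl _ (List.get_mem l i)
  refine ⟨fun i => if h : i < l.length then f ⟨i, h⟩ else 0, fun i hi => ?_⟩
  simp only [dif_pos hi]
  exact ⟨(f ⟨i, hi⟩).2, hf ⟨i, hi⟩⟩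

lemma getElem?_of_positions {B : Type} {label : B → S.Box} {l : List (Place u label)} {f : ℕ → ℕ}
    (hf : ∀ i (hi : i < l.length), ∃ h : f i < u.length, l[i] = .inl ⟨f i, h⟩) {i : ℕ}
    (hi : i < l.length) : u[f i]? = (l.map Place.type)[i]? := by
  obtain ⟨h1, h2⟩ := hf i hi
  rw [List.getElem?_map, List.getElem?_eq_getElem hi, List.getElem?_eq_getElem h1, h2]
  rfl

section extract

variable (d : Diagram S u v) (b₀ : d.Box)

lemma src_length : (d.src b₀).length = (S.dom (d.label b₀)).length := by
  rw [← d.src_type, List.length_map]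

variable {f : ℕ → ℕ} (hf : ∀ i (hi : i < (d.src b₀).length), ∃ h : f i < u.length,
      (d.src b₀)[i] = .inl ⟨f i, h⟩)

lemma compat_extract (hf : ∀ i (hi : i < (d.src b₀).length), ∃ h : f i < u.length,
      (d.src b₀)[i] = .inl ⟨f i, h⟩) :
    Compat u (S.dom (d.label b₀) ++ u) (fun i => if i < (S.dom (d.label b₀)).length then f i
      else i - (S.dom (d.label b₀)).length) := by
  intro i hi
  dsimp only
  split_ifs with h
  · have := getElem?_of_positions hf (i := i) (by rwa [src_length])
    rw [List.getElem?_append_left h, this, d.src_type]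
  · rw [List.getElem?_append_right (by omega)]

/-- The diagram that first evaluates the box `b₀`, whose inputs are inputs of the diagram `d`, and
then the other boxes of `d`. -/
noncomputable def extract : Diagram S u v :=
  (rewireDiagram _ _ _ (d.compat_extract b₀ hf)).comp
    (((single (d.label b₀)).tensor (id u)).comp
      (d.cut (d.label b₀) (fun b => b = b₀) fun _ h => congrArg _ h))

/-- The boxes of `d.extract b₀` as boxes of `d`. -/
noncomputable def extractBox : (d.extract b₀ hf).Box → d.Box
  | .inl b => b.elim
  | .inr (.inl (.inl _)) => b₀
  | .inr (.inl (.inr b)) => b.elim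
  | .inr (.inr b) => b.1

lemma extractBox_label (b : (d.extract b₀ hf).Box) :
    d.label (d.extractBox b₀ hf b) = (d.extract b₀ hf).label b := by
  obtain b | (b | b) | b := b
  exacts [b.elim, rfl, b.elim, rfl]

/-- The wires of `d.extract b₀` as wires of `d`. -/
noncomputable def extractPlace : Place u (d.extract b₀ hf).label → Place u d.label :=
  Place.map (d.extractBox b₀ hf) (d.extractBox_label b₀ hf)

lemma extractPlace_right (p : Place u d.label) : p = extractPlace d b₀ hf
    (compRight _ _ (compRight _ _
      (p.cut (A := fun b => b = b₀) fun _ h => congrArg d.label h))) := by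
  obtain i | ⟨b, j⟩ := p
  · have h1 : i.val < (id u).out.length := by rw [← out_length]; exact i.2
    have h2 := compRight_tensor_right (single (d.label b₀)) (id u)
      (d.cut (d.label b₀) (fun b => b = b₀) fun _ h => congrArg _ h)
      ⟨(S.cod (d.label b₀)).length + i, by simp⟩ i h1 rfl
    rw [id_out_getElem _ _ _ i.2] at h2
    refine Eq.trans ?_ (congrArg (fun q => extractPlace d b₀ hf (compRight _ _ q)) h2.symm)
    refine (Eq.trans (congrArg (extractPlace d b₀ hf) (compRight_rewireDiagram _ _ _)) ?_).symm
    refine congrArg Sum.inl (Fin.ext ?_)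
    simp
  · by_cases hb : b = b₀
    · subst hb
      rw [Place.cut_inr_pos (A := fun b' => b' = b) _ rfl]
      have h2 := compRight_tensor_left (single (d.label b)) (id u)
        (d.cut (d.label b) (fun b' => b' = b) fun _ h => congrArg _ h)
        ⟨j, by simp; omega⟩ (by rw [← out_length]; exact j.2)
      rw [single_out_getElem _ _ _ j.2] at h2
      exact (congrArg (fun q => extractPlace d b hf (compRight _ _ q)) h2).symm
    · exact (congrArg (fun q => extractPlace d b₀ hf (compRight _ _ (compRight _ _ q)))
        (Place.cut_inr_neg (A := fun b => b = b₀) (fun _ h => congrArg d.label h) hb j)).symm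

/-- A box all of whose inputs are inputs of the diagram can be evaluated first. -/
noncomputable def extractHom : Hom (d.extract b₀ hf) d where
  box := d.extractBox b₀ hf
  injective := by
    rintro (b | (b | b) | b)
    · exact b.elim
    · rintro (b' | (b' | b') | b') h
      exacts [b'.elim, rfl, b'.elim, absurd h.symm b'.2]
    · exact b.elim
    · rintro (b' | (b' | b') | b') h
      exacts [b'.elim, absurd h b.2, b'.elim,
        congrArg (fun b => Sum.inr (Sum.inr b)) (Subtype.ext h)]
  label_eq := d.extractBox_label b₀ hf
  src_eq := by
    rintro (b | (b | b) | b)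
    · exact b.elim
    · change d.src b₀ = (((((List.finRange _).map _).map _).map _).map _).map _
      refine eq_map_finRange₅ (d.src_length b₀) fun i h1 h2 => ?_
      obtain ⟨h3, h4⟩ := hf i h1
      rw [h4]
      refine (Eq.trans (congrArg (extractPlace d b₀ hf) (compRight_rewireDiagram _ _ _)) ?_).symm
      exact congrArg Sum.inl (Fin.ext (if_pos h2))
    · exact b.elim
    · change d.src b.1 = ((((d.src b.1).map _).map _).map _).map _
      exact eq_map₄ (d.extractPlace_right b₀ hf)
  out_eq := by
    change d.out = (((d.out.map _).map _).map _).map _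
    exact eq_map₄ (d.extractPlace_right b₀ hf)

end extract

end Diagram

namespace FreeMarkov

/-- Induction on the number of boxes, extracting a box that is not fed by others. -/
lemma generated_ofDiagram {u v : List S.Wire} (d : Diagram S u v) : Generated (ofDiagram d) := by
  induction hn : Nat.card d.Box using Nat.strong_induction_on generalizing u with
  | _ n ih =>
    have := d.finite
    obtain he | hne := isEmpty_or_nonempty d.Box
    · obtain ⟨f, hf⟩ := Diagram.exists_positions d.out fun p _ => by
        obtain i | ⟨b, -⟩ := p
        exacts [⟨i, rfl⟩, (he.false b).elim]
      have hc : Compat u v f := fun i hi => by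
        rw [Diagram.getElem?_of_positions hf (by rwa [← d.out_length]), d.out_type]
      rw [ofDiagram_eq_rewire hc d he fun i hi _ => (hf i hi).2]
      exact generated_rewire _ _ _ _
    · obtain ⟨b₀, hb₀⟩ := exists_box_not_fed d hne
      obtain ⟨f, hf⟩ := Diagram.exists_positions (d.src b₀) hb₀
      rw [← ofDiagram_eq (d.extractHom b₀ hf), Diagram.extract, ofDiagram_comp, ofDiagram_comp,
        ofDiagram_tensor, ← id_eq_ofDiagram]
      refine .comp (generated_rewire _ _ _ _)
        (.comp (.tensor (.box _) (.id _)) (ih _ ?_ _ rfl))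
      rw [← hn]
      exact Finite.card_subtype_lt (p := fun b => ¬ b = b₀) (x := b₀) (by simp)

/-- The free Markov category is generated by its copy and delete maps and its boxes. -/
lemma generated {u v : FreeMarkov S} (f : u ⟶ v) : Generated f := by
  obtain ⟨d, rfl⟩ := exists_ofDiagram f
  exact generated_ofDiagram d

end FreeMarkov

variable {M : Type u} [Category.{v} M] [MonoidalCategory M] [MarkovCategory M]

/-- Strict Markov functors that agree on objects and boxes are equal. -/
lemma IsStrictMarkov.ext {P Q : FreeMarkov S ⥤ Joint M} (hP : IsStrictMarkov P)
    (hQ : IsStrictMarkov Q) (hobj : ∀ u, P.obj u = Q.obj u)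
    (hbox : ∀ b, P.map (FreeMarkov.box b) =
      eqToHom (hobj _) ≫ Q.map (FreeMarkov.box b) ≫ eqToHom (hobj _).symm) : P = Q := by
  obtain ⟨obj, map, map_id, map_comp⟩ := P
  obtain ⟨obj', map', map_id', map_comp'⟩ := Q
  obtain rfl : obj = obj' := funext hobj
  simp only [eqToHom_refl, Category.id_comp, Category.comp_id] at hbox
  have key {u v : FreeMarkov S} (f : u ⟶ v) : map f = map' f := by
    induction FreeMarkov.generated f with
    | id u => rw [map_id, map_id']
    | comp _ _ hf hg => rw [map_comp, map_comp', hf, hg]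
    | tensor _ _ hf hg =>
      refine (hP.map_tensor _ _).trans (Eq.trans ?_ (hQ.map_tensor _ _).symm)
      simp only [hf, hg]
    | copy u => exact (hP.map_copy u).trans (hQ.map_copy u).symm
    | del u => exact (hP.map_del u).trans (hQ.map_del u).symm
    | box b => exact hbox b
  congr 1
  funext u v f
  exact key f

end JointCausal

open CategoryTheory MonoidalCategory JointCausal in
/-- A joint factorization `(f, φ, F)` and an intervention induce a unique strict Markov functor
`Int` that agrees with `F` on objects, with `F` on the boxes left alone and with the constants on the
intervened boxes, together with an interventional distribution `Int φ`. -/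
theorem mainTheorem5 {M : Type*} [Category* M] [MonoidalCategory M] [MarkovCategory M]
    [IsStrictMonoidal M] {S : Hypergraph} [Finite S.Wire] [Finite S.Box]
    (J : JointFactorization S M) (act : Intervention J.F) :
    ∃! P : (FreeMarkov S ⥤ Joint M) × (J.F.obj J.dom ⟶ J.F.obj J.cod),
      ∃ hobj : ∀ u, P.1.obj u = J.F.obj u,
        IsStrictMarkov P.1 ∧
        (∀ b : S.Box, P.1.map (FreeMarkov.box b) =
          eqToHom (hobj _) ≫ act.box b ≫ eqToHom (hobj _).symm) ∧
        P.2 = eqToHom (hobj _).symm ≫ P.1.map J.φ ≫ eqToHom (hobj _) := by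
  obtain ⟨G, hobj, hG, hbox⟩ := J.strict.exists_intervention act
  refine ⟨⟨G, eqToHom (hobj _).symm ≫ G.map J.φ ≫ eqToHom (hobj _)⟩, ⟨hobj, hG, hbox, rfl⟩, ?_⟩
  rintro ⟨P, f⟩ ⟨hobj', hP, hbox', hf⟩
  dsimp only at hobj' hP hbox' hf
  obtain rfl : P = G := hP.ext hG (fun u => (hobj' u).trans (hobj u).symm) fun b => by
    rw [hbox', hbox]
    simp
  rw [hf]
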